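/- **Setting.** For integers $n\ge 2$, $k,d\ge 1$, unit vectors $x_1,\dots,x_n\in\mathbb R^d$ and $\varepsilon>0$ define, for $M\in\mathbb R^{k\times d}$ and $\sigma^2\ge 0$, $$g(M,\sigma^2)=\sum_{j=1}^n \Pr_{A\sim N(M,\sigma^2)}\Big[\tfrac1k\|Ax_j\|_2^2\notin(1-\varepsilon,1+\varepsilon)\Big]+\frac{\sigma^2}{2},$$ where $A\sim N(M,\sigma^2)$ means that the entries $a_{ij}\sim N(M_{ij},\sigma^2)$ of $A\in\mathbb R^{k\times d}$ are independent. The function $g$ is regarded as a function on the Euclidean space $\mathbb R^{kd+1}$ of pairs $(M,\sigma^2)$, with gradient $\nabla g$ and Hessian $\nabla^2 g$. **Algorithm (Hessian descent)** with parameters $L,K,\rho>0$ and a minimum admitted variance $\sigma_0^2>0$. Start at $x_0=(0,1)$. At $x_t=(M_t,\sigma_t^2)$: 1. if $\sigma_t^2\le\sigma_0^2$, stop and return $M_t$; 2. otherwise, if $\|\nabla g(x_t)\|_2>\rho$, set $x_{t+1}=x_t-\frac1L\nabla g(x_t)$; 3. otherwise, if $\lambda_{\min}(\nabla^2 g(x_t))<-\sqrt{K\rho}$,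 set $x_{t+1}=x_t+\frac{3\sqrt\rho}{K}u_1$, where $u_1$ is a unit eigenvector of $\nabla^2 g(x_t)$ for its smallest eigenvalue (chosen by any fixed rule); 4. otherwise stop and return $M_t$. **Theorem.** There are absolute constants $C,D>0$ and $c\in\mathbb N$ such that for all integers $n\ge2$, $k,d\ge1$ there are parameters $\sigma_0^2,L,K,\rho_0>0$, depending only on $n,k,d$, with $$(nkd)^{-c}\le\sigma_0^2\le \tfrac1k,\qquad 0<L\le (nkd)^c,\qquad 0<K\le (nkd)^c,\qquad \rho_0\ge (nkd)^{-c},$$ for which the following holds for every $\varepsilon\ge C\sqrt{\log n/k}$ and all unit vectors $x_1,\dots,x_n\in\mathbb R^d$. On the region $\{\sigma^2\ge\sigma_0^2\}$ the function $g$ is twice differentiable, $L$-smooth ($\nabla g$ is $L$-Lipschitz) and $K$-Hessian Lipschitz ($\nabla^2 g$ is $K$-Lipschitz in operator norm). For every $0<\rho\le\rho_0$ and every rule for choosing the eigenvectors, the deterministic algorithm above stops after at most $(nkd)^c/\rho^2$ passes through its loop (so after $\mathrm{poly}(n,k,d)$ steps for $\rho=\rho_0$), at a point $(M,\sigma^2)$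 with $\sigma^2>0$, and the returned matrix $M$ satisfies the Johnson–Lindenstrauss guarantee with distortion $O(\varepsilon)$: $$\Big|\tfrac1k\|Mx_j\|_2^2-1\Big|\le D\,\varepsilon\qquad\text{for all }j=1,\dots,n.$$ -/

import Mathlib

open MeasureTheory ProbabilityTheory
open scoped Matrix

noncomputable section

/-- The parameter space of pairs `(M, σ²)`, with `M` a `k × d` matrix and `σ²` a real number:
Euclidean space of dimension `k * d + 1`, with norm `√(‖M‖_F ^ 2 + (σ²) ^ 2)`. -/
abbrev Param (k d : ℕ) : Type := EuclideanSpace ℝ ((Fin k × Fin d) ⊕ Unit)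

/-- The mean matrix `M` of the pair `(M, σ²)`. -/
def Param.mean {k d : ℕ} (p : Param k d) : Matrix (Fin k) (Fin d) ℝ :=
  Matrix.of fun i j => p (Sum.inl (i, j))

/-- The variance `σ²` of the pair `(M, σ²)`. -/
def Param.var {k d : ℕ} (p : Param k d) : ℝ := p (Sum.inr ())

/-- The pair `(M, v)`. -/
def Param.mk {k d : ℕ} (M : Matrix (Fin k) (Fin d) ℝ) (v : ℝ) : Param k d :=
  WithLp.toLp 2 (Sum.elim (fun ij : Fin k × Fin d => M ij.1 ij.2) (fun _ => v))

/-- The law `N(M, v)` of a random `k × d` matrix with independent entries `a i j ∼ N(M i j, v)`.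
For `v = 0` this is the point mass at `M`; negative `v` is outside the domain and is read as `0`. -/
def gaussianMatrix {k d : ℕ} (M : Matrix (Fin k) (Fin d) ℝ) (v : ℝ) :
    Measure (Fin k → Fin d → ℝ) :=
  Measure.pi fun i => Measure.pi fun j => gaussianReal (M i j) v.toNNReal

/-- The normalized squared length `(1 / k) * ‖A x‖ ^ 2` of the image of `x` under `A`. -/
def normSqImage {k d : ℕ} (A : Matrix (Fin k) (Fin d) ℝ) (x : EuclideanSpace ℝ (Fin d)) : ℝ :=
  (1 / (k : ℝ)) * ‖(WithLp.toLp 2 (A *ᵥ x.ofLp) : EuclideanSpace ℝ (Fin k))‖ ^ 2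

/-- `f(M, σ²) = ∑ j, Pr_{A ∼ N(M, σ²)} [(1 / k) ‖A x_j‖ ^ 2 ∉ (1 - ε, 1 + ε)]`. -/
def failureSum {n k d : ℕ} (x : Fin n → EuclideanSpace ℝ (Fin d)) (ε : ℝ) (p : Param k d) : ℝ :=
  ∑ j, (gaussianMatrix p.mean p.var).real
    {A | normSqImage (Matrix.of A) (x j) ∉ Set.Ioo (1 - ε) (1 + ε)}

/-- The regularized objective `g(M, σ²) = f(M, σ²) + σ² / 2`. -/
def objective {n k d : ℕ} (x : Fin n → EuclideanSpace ℝ (Fin d)) (ε : ℝ) (p : Param k d) : ℝ :=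
  failureSum x ε p + p.var / 2

section Optimization

variable {E : Type*} [NormedAddCommGroup E] [InnerProductSpace ℝ E] [CompleteSpace E]

/-- The Hessian of `g` at `p`, as the operator `v ↦ D(∇g)(p) v`. -/
def hessian (g : E → ℝ) (p : E) : E →L[ℝ] E := fderiv ℝ (gradient g) p

/-- The smallest eigenvalue of the Hessian of `g` at `p`. -/
def hessianMinEig (g : E → ℝ) (p : E) : ℝ :=
  sInf {μ : ℝ | Module.End.HasEigenvalue (hessian g p : E →ₗ[ℝ] E) μ}

/-- `v` is a unit eigenvector of the Hessian of `g` at `p` for its smallest eigenvalue. -/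
def IsMinEigenvector (g : E → ℝ) (p v : E) : Prop :=
  Module.End.HasEigenvector (hessian g p : E →ₗ[ℝ] E) (hessianMinEig g p) v ∧ ‖v‖ = 1

/-- `u` is a rule that selects, at every point where there is one, a unit eigenvector of the
Hessian for its smallest eigenvalue. (There is one wherever `g` is twice continuously
differentiable; its sign, and more if the eigenvalue is multiple, is up to the rule.) -/
def IsEigenvectorRule (g : E → ℝ) (u : E → E) : Prop :=
  ∀ p, (∃ v, IsMinEigenvector g p v) → IsMinEigenvector g p (u p)

/-- `g` is `L`-smooth on `S`. -/
def IsSmoothOn (g : E → ℝ) (L : ℝ) (S : Set E) : Prop :=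
  (∀ p ∈ S, DifferentiableAt ℝ g p) ∧
    ∀ p ∈ S, ∀ q ∈ S, ‖gradient g p - gradient g q‖ ≤ L * ‖p - q‖

/-- `g` is `K`-Hessian Lipschitz on `S`. -/
def IsHessianLipschitzOn (g : E → ℝ) (K : ℝ) (S : Set E) : Prop :=
  (∀ p ∈ S, DifferentiableAt ℝ g p ∧ DifferentiableAt ℝ (gradient g) p) ∧
    ∀ p ∈ S, ∀ q ∈ S, ‖hessian g p - hessian g q‖ ≤ K * ‖p - q‖

end Optimization

/-- The state of a descent run: either a current iterate, or stopped at the reported iterate. -/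
inductive DescentState (α : Type) : Type
  | running (p : α) : DescentState α
  | stopped (p : α) : DescentState α

open Classical in
/-- One pass through the loop of Hessian descent on `g`, for the constants `L`, `K`, the tolerance
`ρ`, the smallest admitted variance `s` and the eigenvector rule `u`. The run stops at the current
iterate once its variance has come down to `s`. Otherwise it takes a gradient step of step size
`1 / L` if the gradient is larger than `ρ`, a step of length `3 * √ρ / K` along an eigenvector of
the smallest eigenvalue of the Hessian if that eigenvalue is below `-√(K * ρ)`, and it stops if
neither is the case. -/
def descentStep {k d : ℕ} (g : Param k d → ℝ) (L K ρ s : ℝ) (u : Param k d → Param k d) :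
    DescentState (Param k d) → DescentState (Param k d)
  | .stopped p => .stopped p
  | .running p =>
    if p.var ≤ s then .stopped p
    else if ρ < ‖gradient g p‖ then .running (p - (1 / L) • gradient g p)
    else if hessianMinEig g p < -Real.sqrt (K * ρ) then
      .running (p + (3 * Real.sqrt ρ / K) • u p)
    else .stopped p

/-- The state after `t` passes through the loop, from the initial point `(0, 1)`. -/
def hessianDescent {k d : ℕ} (g : Param k d → ℝ) (L K ρ s : ℝ) (u : Param k d → Param k d)
    (t : ℕ) : DescentState (Param k d) :=
  (descentStep g L K ρ s u)^[t] (.running (Param.mk 0 1))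

/-- The matrix `M` has distortion at most `η` on the (unit) vectors `x j`. -/
def HasDistortionAtMost {n k d : ℕ} (M : Matrix (Fin k) (Fin d) ℝ)
    (x : Fin n → EuclideanSpace ℝ (Fin d)) (η : ℝ) : Prop :=
  ∀ j, |normSqImage M (x j) - 1| ≤ η

end

/-! ### Taylor bounds from Lipschitz gradients and Hessians. -/

section TaylorBounds

/-! Write `f` for the failure sum, so that `g = f + σ²/2`. The density of `N(M, σ²)` solves the heat
equation, hence so does every Gaussian average: `∂f/∂σ² = (1/2) Δ_M f` (`heat_equation`). If `‖∇g‖ ≤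
ρ`, the variance component gives `Δ_M f ≤ 2ρ - 1`; averaging over the `kd` entry directions, the
Hessian has an eigenvalue at most `(2ρ - 1)/(kd)` (`hessianMinEig_mul_le`). So for small `ρ` there
is no approximate local minimum of positive variance: the algorithm always has a descent step and
can stop only because the variance is small. Each step lowers `g` by a fixed inverse polynomial
amount and `g ≥ 0`, which bounds the number of passes (`DescentData.exists_stopped`).

Polynomial bounds on the gradient, Hessian and third derivative come from complex analysis. Along
any line the Gaussian density extends holomorphically to a disc of inverse polynomial radius, where
its modulus is dominated by a slightly wider Gaussian of total mass at most 3. A Gaussian average is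
therefore bounded and holomorphic on the disc, and Cauchy's estimates apply
(`hasHolomorphicSlices_gaussianAverage`, `objective_regularity`).

If `ε ≤ 1`, the chi-square tail bound gives `f ≤ 1/4` at the start, so `g ≤ 3/4` throughout. At the
end the variance is at most `1/k`, and Markov's inequality shows that for each `j` some matrix `A`
both succeeds on `x_j` and has `‖(A - M) x_j‖² < 8`; this transfers the guarantee to `M`
(`hasDistortionAtMost_of_failureSum_le`). If `ε > 1`, failure only means that the image is too long.
On the slice `M = 0` the gradient is then vertical by symmetry, with variance component at least
`1/2` by scaling, so the run never leaves the slice and returns `0`, whose distortion is `1`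
(`hessianDescent_mean_eq_zero`, `gradient_objective_of_mean_eq_zero`). -/

theorem le_of_hasDerivAt_le_Icc {φ φ' B B' : ℝ → ℝ}
    (hφ : ∀ t ∈ Set.Icc (0 : ℝ) 1, HasDerivAt φ (φ' t) t)
    (hB : ∀ t, HasDerivAt B (B' t) t) (h0 : φ 0 ≤ B 0)
    (h : ∀ t ∈ Set.Icc (0 : ℝ) 1, φ' t ≤ B' t) :
    ∀ t ∈ Set.Icc (0 : ℝ) 1, φ t ≤ B t :=
  image_le_of_deriv_right_le_deriv_boundary
    (fun t ht => (hφ t ht).continuousAt.continuousWithinAt)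
    (fun t ht => (hφ t ⟨ht.1, ht.2.le⟩).hasDerivWithinAt) h0
    (fun t _ => (hB t).continuousAt.continuousWithinAt)
    (fun t _ => (hB t).hasDerivWithinAt) (fun t ht => h t ⟨ht.1, ht.2.le⟩)

variable {E : Type*} [NormedAddCommGroup E] [InnerProductSpace ℝ E] [CompleteSpace E]

theorem hasDerivAt_comp_line {g : E → ℝ} {p d : E} {t : ℝ}
    (hg : DifferentiableAt ℝ g (p + t • d)) :
    HasDerivAt (fun s : ℝ => g (p + s • d)) (inner ℝ (gradient g (p + t • d)) d) t := by
  have h1 : HasDerivAt (fun s : ℝ => p + s • d) d t := by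
    simpa using ((hasDerivAt_id t).smul_const d).const_add p
  have h2 := hg.hasGradientAt.hasFDerivAt.comp_hasDerivAt t h1
  simpa using! h2

theorem hasDerivAt_inner_gradient_comp_line {g : E → ℝ} {p d u : E} {t : ℝ}
    (hg : DifferentiableAt ℝ (gradient g) (p + t • d)) :
    HasDerivAt (fun s : ℝ => inner ℝ (gradient g (p + s • d)) u)
      (inner ℝ (hessian g (p + t • d) d) u) t := by
  have h1 : HasDerivAt (fun s : ℝ => p + s • d) d t := by
    simpa using ((hasDerivAt_id t).smul_const d).const_add p
  have h2 := hg.hasFDerivAt.comp_hasDerivAt t h1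
  simpa [hessian] using h2.inner ℝ (hasDerivAt_const t u)

/-- Compare derivatives along the segment: the slope at time `t` exceeds the initial slope by at
most `L t ‖d‖²`. -/
theorem IsSmoothOn.le_quadratic {g : E → ℝ} {L : ℝ} {S : Set E} (hg : IsSmoothOn g L S)
    (hS : Convex ℝ S) {p d : E} (hp : p ∈ S) (hq : p + d ∈ S) :
    g (p + d) ≤ g p + inner ℝ (gradient g p) d + L / 2 * ‖d‖ ^ 2 := by
  have hm := fun t ht => hS.add_smul_mem hp hq (t := t) ht
  have key := le_of_hasDerivAt_le_Icc (φ := fun s : ℝ => g (p + s • d))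
    (B := fun t => g p + inner ℝ (gradient g p) d * t + L / 2 * ‖d‖ ^ 2 * t ^ 2)
    (B' := fun t => inner ℝ (gradient g p) d * 1 + L / 2 * ‖d‖ ^ 2 * (2 * t))
    (fun t ht => hasDerivAt_comp_line (hg.1 _ (hm t ht)))
    (fun t => by
      have := (((hasDerivAt_id t).const_mul (inner ℝ (gradient g p) d)).const_add (g p)).add
        (((hasDerivAt_id t).pow 2).const_mul (L / 2 * ‖d‖ ^ 2))
      simpa using! this) (by simp)
    (fun t ht => by
      have h1 : inner ℝ (gradient g (p + t • d) - gradient g p) d ≤ L * ‖t • d‖ * ‖d‖ := by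
        refine (real_inner_le_norm _ _).trans ?_
        gcongr
        simpa using hg.2 _ (hm t ht) _ hp
      rw [inner_sub_left, norm_smul, Real.norm_of_nonneg ht.1] at h1
      nlinarith)
    1 (by simp)
  simpa using key

/-- The same comparison applied twice, first to the slope along the segment and then to the
function. -/
theorem IsHessianLipschitzOn.le_cubic {g : E → ℝ} {K : ℝ} {S : Set E}
    (hg : IsHessianLipschitzOn g K S)
    (hS : Convex ℝ S) {p d : E} (hp : p ∈ S) (hq : p + d ∈ S) :
    g (p + d) ≤ g p + inner ℝ (gradient g p) d + inner ℝ (hessian g p d) d / 2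
      + K / 6 * ‖d‖ ^ 3 := by
  have hm := fun t ht => hS.add_smul_mem hp hq (t := t) ht
  have key1 := le_of_hasDerivAt_le_Icc
    (φ := fun s : ℝ => inner ℝ (gradient g (p + s • d)) d)
    (B := fun t => inner ℝ (gradient g p) d + inner ℝ (hessian g p d) d * t
      + K / 2 * ‖d‖ ^ 3 * t ^ 2)
    (B' := fun t => inner ℝ (hessian g p d) d * 1 + K / 2 * ‖d‖ ^ 3 * (2 * t))
    (fun t ht => hasDerivAt_inner_gradient_comp_line (hg.1 _ (hm t ht)).2)
    (fun t => by
      have := (((hasDerivAt_id t).const_mul (inner ℝ (hessian g p d) d)).const_add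
        (inner ℝ (gradient g p) d)).add
        (((hasDerivAt_id t).pow 2).const_mul (K / 2 * ‖d‖ ^ 3))
      simpa using! this) (by simp)
    (fun t ht => by
      have h1 : inner ℝ (hessian g (p + t • d) d - hessian g p d) d
          ≤ K * ‖t • d‖ * ‖d‖ * ‖d‖ := by
        refine (real_inner_le_norm _ _).trans ?_
        gcongr
        rw [← sub_apply]
        refine (ContinuousLinearMap.le_opNorm _ _).trans ?_
        gcongr
        simpa using hg.2 _ (hm t ht) _ hp
      rw [inner_sub_left, norm_smul, Real.norm_of_nonneg ht.1] at h1
      nlinarith)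
  have key := le_of_hasDerivAt_le_Icc (φ := fun s : ℝ => g (p + s • d))
    (B := fun t => g p + inner ℝ (gradient g p) d * t
      + inner ℝ (hessian g p d) d / 2 * t ^ 2 + K / 6 * ‖d‖ ^ 3 * t ^ 3)
    (B' := fun t => inner ℝ (gradient g p) d * 1
      + inner ℝ (hessian g p d) d / 2 * (2 * t) + K / 6 * ‖d‖ ^ 3 * (3 * t ^ 2))
    (fun t ht => hasDerivAt_comp_line (hg.1 _ (hm t ht)).1)
    (fun t => by
      have := ((((hasDerivAt_id t).const_mul (inner ℝ (gradient g p) d)).const_add (g p)).add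
        (((hasDerivAt_id t).pow 2).const_mul (inner ℝ (hessian g p d) d / 2))).add
        (((hasDerivAt_id t).pow 3).const_mul (K / 6 * ‖d‖ ^ 3))
      simpa using! this) (by simp)
    (fun t ht => (key1 t ht).trans (by nlinarith))
    1 (by simp)
  simpa using key

end TaylorBounds

/-! ### Termination of Hessian descent under abstract hypotheses. -/

section Descent

variable {k d : ℕ}

theorem convex_var_ge (v : ℝ) : Convex ℝ {p : Param k d | v ≤ p.var} := by
  intro p hp q hq a b ha hb hab
  change v ≤ a * p.var + b * q.var
  calc v = a * v + b * v := by rw [← add_mul, hab, one_mul]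
    _ ≤ _ := add_le_add (mul_le_mul_of_nonneg_left hp ha) (mul_le_mul_of_nonneg_left hq hb)

theorem Param.abs_var_le (p : Param k d) : |p.var| ≤ ‖p‖ := by
  simpa [Param.var] using PiLp.norm_apply_le p (Sum.inr ())

theorem Param.var_add (p q : Param k d) : (p + q).var = p.var + q.var := rfl
theorem Param.var_sub (p q : Param k d) : (p - q).var = p.var - q.var := rfl
theorem Param.var_smul (c : ℝ) (p : Param k d) : (c • p).var = c * p.var := rfl
theorem Param.var_mk (M : Matrix (Fin k) (Fin d) ℝ) (v : ℝ) : (Param.mk M v).var = v := rfl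

/-- The analytic facts about an objective under which Hessian descent terminates. -/
structure DescentData (g : Param k d → ℝ) (L K ρ s B ℓ Δ : ℝ) : Prop where
  L_pos : 0 < L
  K_pos : 0 < K
  ρ_pos : 0 < ρ
  s_pos : 0 < s
  smooth : IsSmoothOn g L {p | s / 2 ≤ p.var}
  hess : IsHessianLipschitzOn g K {p | s / 2 ≤ p.var}
  nonneg : ∀ p, 0 ≤ p.var → 0 ≤ g p
  grad_le : ∀ p : Param k d, s / 2 ≤ p.var → ‖gradient g p‖ ≤ B
  B_le : B / L ≤ s / 2
  step_le : 3 * Real.sqrt ρ / K ≤ s / 2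
  curv : ∀ p : Param k d, s ≤ p.var → ‖gradient g p‖ ≤ ρ →
    (∃ v, IsMinEigenvector g p v) ∧ hessianMinEig g p ≤ -ℓ
  curv_lt : Real.sqrt (K * ρ) < ℓ
  Δ_pos : 0 < Δ
  Δ_le_grad : Δ ≤ ρ ^ 2 / (2 * L)
  Δ_le_curv : Δ ≤ (3 * Real.sqrt ρ / K) ^ 2 * ℓ / 2 - 3 * Real.sqrt ρ / K * ρ
    - K / 6 * (3 * Real.sqrt ρ / K) ^ 3

namespace DescentData

variable {g : Param k d → ℝ} {L K ρ s B ℓ Δ : ℝ} {u : Param k d → Param k d}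

/-- A step starts at variance above `s` and changes it by at most `s/2`, so its endpoint stays in
the half-space `s/2 ≤ σ²` where the Taylor bounds are available. -/
theorem gradient_step (h : DescentData g L K ρ s B ℓ Δ) {p : Param k d} (hp : s < p.var)
    (hρ : ρ < ‖gradient g p‖) :
    s / 2 ≤ (p - (1 / L) • gradient g p).var ∧
      g (p - (1 / L) • gradient g p) ≤ g p - Δ := by
  have hs := h.s_pos
  have hL := h.L_pos
  have hp' : s / 2 ≤ p.var := by linarith
  have hvar : s / 2 ≤ (p - (1 / L) • gradient g p).var := by
    rw [Param.var_sub, Param.var_smul]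
    have h1 : 1 / L * (gradient g p).var ≤ B / L := by
      rw [one_div_mul_eq_div]
      gcongr
      exact (le_abs_self _).trans ((Param.abs_var_le _).trans (h.grad_le p hp'))
    linarith [h.B_le]
  refine ⟨hvar, ?_⟩
  have h2 := h.smooth.le_quadratic (convex_var_ge _) (p := p) (d := -((1 / L) • gradient g p)) hp'
    (by rw [← sub_eq_add_neg]; exact hvar)
  rw [← sub_eq_add_neg, inner_neg_right, inner_smul_right, real_inner_self_eq_norm_sq, norm_neg,
    norm_smul, Real.norm_of_nonneg (by positivity)] at h2
  have h3 : ρ ^ 2 ≤ ‖gradient g p‖ ^ 2 := by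
    have := h.ρ_pos
    gcongr
  have h4 : Δ ≤ ‖gradient g p‖ ^ 2 / (2 * L) := h.Δ_le_grad.trans (by gcongr)
  have h5 : -(1 / L * ‖gradient g p‖ ^ 2) + L / 2 * (1 / L * ‖gradient g p‖) ^ 2
      = -(‖gradient g p‖ ^ 2 / (2 * L)) := by field_simp; ring
  linarith

/-- The first conclusion rules out the algorithm's last branch: a point with small gradient always
passes the curvature test. -/
theorem eigenvector_step (h : DescentData g L K ρ s B ℓ Δ) (hu : IsEigenvectorRule g u)
    {p : Param k d} (hp : s < p.var) (hρ : ‖gradient g p‖ ≤ ρ) :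
    hessianMinEig g p < -Real.sqrt (K * ρ) ∧
    s / 2 ≤ (p + (3 * Real.sqrt ρ / K) • u p).var ∧
      g (p + (3 * Real.sqrt ρ / K) • u p) ≤ g p - Δ := by
  have hs := h.s_pos
  have hK := h.K_pos
  obtain ⟨hex, hcurv⟩ := h.curv p hp.le hρ
  obtain ⟨hev, hnorm⟩ := hu p hex
  set η := 3 * Real.sqrt ρ / K with hη
  have hη0 : 0 ≤ η := by positivity
  have hvar : s / 2 ≤ (p + η • u p).var := by
    rw [Param.var_add, Param.var_smul]
    have h1 : |η * (u p).var| ≤ η := by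
      rw [abs_mul, abs_of_nonneg hη0]
      exact mul_le_of_le_one_right hη0 ((Param.abs_var_le _).trans hnorm.le)
    linarith [neg_abs_le (η * (u p).var), h.step_le]
  refine ⟨by linarith [h.curv_lt], hvar, ?_⟩
  have h2 := h.hess.le_cubic (convex_var_ge _) (p := p) (d := η • u p)
    (show s / 2 ≤ p.var by linarith) hvar
  have hH : hessian g p (u p) = hessianMinEig g p • u p := hev.apply_eq_smul
  rw [map_smul, hH, inner_smul_right, inner_smul_right, inner_smul_left, inner_smul_left,
    real_inner_self_eq_norm_sq, norm_smul, hnorm, Real.norm_of_nonneg hη0] at h2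
  -- The sign of the eigenvector is up to the rule, so the linear term may be adverse; it costs at
  -- most `ρ` per unit length.
  have h3 : inner ℝ (gradient g p) (u p) ≤ ρ := by
    have := real_inner_le_norm (gradient g p) (u p)
    rw [hnorm, mul_one] at this
    linarith
  have h4 := mul_le_mul_of_nonneg_left h3 hη0
  have h5 := mul_le_mul_of_nonneg_left hcurv (sq_nonneg η)
  have h6 := h.Δ_le_curv
  simp only [conj_trivial] at h2
  nlinarith

theorem exists_stopped_or_running (h : DescentData g L K ρ s B ℓ Δ) (hu : IsEigenvectorRule g u)
    (hs1 : s ≤ 1) (t : ℕ) :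
    (∃ T ≤ t, ∃ p, hessianDescent g L K ρ s u T = .stopped p ∧ s / 2 ≤ p.var ∧ p.var ≤ s ∧
      g p ≤ g (Param.mk 0 1)) ∨
    ∃ p, hessianDescent g L K ρ s u t = .running p ∧ s / 2 ≤ p.var ∧
      g p ≤ g (Param.mk 0 1) - t * Δ := by
  have hs := h.s_pos
  induction t with
  | zero => exact .inr ⟨_, rfl, by rw [Param.var_mk]; linarith, by simp⟩
  | succ t ih =>
    rcases ih with ⟨T, hT, hp⟩ | ⟨p, hp, hv, hg⟩
    · exact .inl ⟨T, by omega, hp⟩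
    have hstep : hessianDescent g L K ρ s u (t + 1) = descentStep g L K ρ s u (.running p) := by
      rw [hessianDescent, Function.iterate_succ_apply', ← hp, hessianDescent]
    by_cases hps : p.var ≤ s
    · refine .inl ⟨t + 1, le_rfl, p, ?_, hv, hps, ?_⟩
      · rw [hstep, descentStep, if_pos hps]
      · have := h.Δ_pos
        nlinarith [show (0 : ℝ) ≤ t by positivity]
    push Not at hps
    right
    by_cases hρ : ρ < ‖gradient g p‖
    · obtain ⟨h1, h2⟩ := h.gradient_step hps hρ
      refine ⟨_, ?_, h1, ?_⟩
      · rw [hstep, descentStep, if_neg (not_le.2 hps), if_pos hρ]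
      · push_cast
        linarith
    · obtain ⟨h0, h1, h2⟩ := h.eigenvector_step hu hps (not_lt.1 hρ)
      refine ⟨_, ?_, h1, ?_⟩
      · rw [hstep, descentStep, if_neg (not_le.2 hps), if_neg hρ, if_pos h0]
      · push_cast
        linarith

theorem exists_stopped (h : DescentData g L K ρ s B ℓ Δ) (hu : IsEigenvectorRule g u)
    (hs1 : s ≤ 1) :
    ∃ (T : ℕ) (p : Param k d), (T : ℝ) ≤ g (Param.mk 0 1) / Δ + 1 ∧
      hessianDescent g L K ρ s u T = .stopped p ∧ 0 < p.var ∧ p.var ≤ s ∧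
      g p ≤ g (Param.mk 0 1) := by
  have hΔ := h.Δ_pos
  have hs := h.s_pos
  have h0 : 0 ≤ g (Param.mk (0 : Matrix (Fin k) (Fin d) ℝ) 1) :=
    h.nonneg _ (by rw [Param.var_mk]; norm_num)
  have hfl := Nat.floor_le (div_nonneg h0 hΔ.le)
  -- After this many passes a run that has not stopped would have made `g` negative.
  rcases h.exists_stopped_or_running hu hs1 (⌊g (Param.mk 0 1) / Δ⌋₊ + 1) with
    ⟨T, hT, p, hp, hv, hvs, hg⟩ | ⟨p, -, hv, hg⟩
  · refine ⟨T, p, ?_, hp, by linarith, hvs, hg⟩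
    have : (T : ℝ) ≤ ((⌊g (Param.mk 0 1) / Δ⌋₊ + 1 : ℕ) : ℝ) := by exact_mod_cast hT
    push_cast at this
    linarith
  · have h1 := h.nonneg p (by linarith)
    have h2 := Nat.lt_floor_add_one (g (Param.mk (0 : Matrix (Fin k) (Fin d) ℝ) 1) / Δ)
    rw [div_lt_iff₀ hΔ] at h2
    push_cast at hg
    linarith

end DescentData

/-- If every gradient on the slice `M = 0` is vertical and larger than `ρ`, then the run never
leaves that slice. -/
theorem hessianDescent_mean_eq_zero {g : Param k d → ℝ} {L K ρ s : ℝ}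
    {u : Param k d → Param k d}
    (hmean : ∀ p : Param k d, p.mean = 0 → s < p.var →
      (gradient g p).mean = 0 ∧ ρ < ‖gradient g p‖) (t : ℕ) :
    ∃ p : Param k d, p.mean = 0 ∧ (hessianDescent g L K ρ s u t = .running p ∨
      hessianDescent g L K ρ s u t = .stopped p) := by
  induction t with
  | zero => exact ⟨_, by ext; simp [Param.mean, Param.mk], .inl rfl⟩
  | succ t ih =>
    obtain ⟨p, hp, hr⟩ := ih
    rw [hessianDescent, Function.iterate_succ_apply', ← hessianDescent]
    rcases hr with hr | hr
    · rw [hr, descentStep]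
      by_cases hps : p.var ≤ s
      · exact ⟨p, hp, .inr (if_pos hps)⟩
      · obtain ⟨h1, h2⟩ := hmean p hp (not_le.1 hps)
        refine ⟨p - (1 / L) • gradient g p, ?_, .inl ?_⟩
        · ext i j
          have e1 := congrFun (congrFun hp i) j
          have e2 := congrFun (congrFun h1 i) j
          simp only [Param.mean, Matrix.of_apply, Matrix.zero_apply] at e1 e2
          simp [Param.mean, e1, e2]
        · rw [if_neg hps, if_pos h2]
    · exact ⟨p, hp, .inr (by rw [hr, descentStep])⟩

end Descent

/-! ### Cauchy estimates for functions with holomorphic restrictions to lines. -/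

section HolomorphicSlices

open Metric

/-- The real derivative of `Re Φ` along the real axis is the real part of the complex derivative;
induct on the order using uniqueness of derivatives. -/
theorem eq_re_iteratedDeriv_of_slice {Φ : ℂ → ℂ} {r : ℝ} (hΦ : DifferentiableOn ℂ Φ (ball 0 r))
    {e : ℕ → ℝ → ℝ} {N : ℕ}
    (he : ∀ m < N, ∀ t : ℝ, |t| < r → HasDerivAt (e m) (e (m + 1) t) t)
    (h0 : ∀ t : ℝ, |t| < r → e 0 t = (Φ t).re) :
    ∀ m ≤ N, ∀ t : ℝ, |t| < r → e m t = (iteratedDeriv m Φ t).re := by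
  intro m
  induction m with
  | zero => intro _ t ht; rw [iteratedDeriv_zero]; exact h0 t ht
  | succ m ih =>
    intro hm t ht
    have hmem : (t : ℂ) ∈ ball (0 : ℂ) r := by simpa using ht
    have han : AnalyticAt ℂ (iteratedDeriv m Φ) t := by
      rw [iteratedDeriv_eq_iterate]
      exact (hΦ.analyticAt (isOpen_ball.mem_nhds hmem)).iterated_deriv m
    have h1 : HasDerivAt (fun s : ℝ => (iteratedDeriv m Φ s).re)
        (deriv (iteratedDeriv m Φ) t).re t :=
      han.differentiableAt.hasDerivAt.real_of_complex
    have h2 : e m =ᶠ[nhds t] fun s : ℝ => (iteratedDeriv m Φ s).re := by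
      have : {s : ℝ | |s| < r} ∈ nhds t := (isOpen_lt continuous_abs continuous_const).mem_nhds ht
      filter_upwards [this] with s hs using ih (by omega) s hs
    rw [iteratedDeriv_succ]
    exact (he m (by omega) t ht).unique (h1.congr_of_eventuallyEq h2)

/-- Cauchy's estimate on the circle of radius `r/2`, which lies inside the open disc. -/
theorem abs_le_of_slice {Φ : ℂ → ℂ} {r B : ℝ} (hr : 0 < r)
    (hΦ : DifferentiableOn ℂ Φ (ball 0 r)) (hB : ∀ z ∈ ball (0 : ℂ) r, ‖Φ z‖ ≤ B)
    {e : ℕ → ℝ → ℝ} {N : ℕ}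
    (he : ∀ m < N, ∀ t : ℝ, |t| < r → HasDerivAt (e m) (e (m + 1) t) t)
    (h0 : ∀ t : ℝ, |t| < r → e 0 t = (Φ t).re) {m : ℕ} (hm : m ≤ N) :
    |e m 0| ≤ m.factorial * B / (r / 2) ^ m := by
  rw [eq_re_iteratedDeriv_of_slice hΦ he h0 m hm 0 (by simpa using hr)]
  refine (Complex.abs_re_le_norm _).trans ?_
  rw [Complex.ofReal_zero]
  have hsub : closedBall (0 : ℂ) (r / 2) ⊆ ball 0 r := closedBall_subset_ball (by linarith)
  refine Complex.norm_iteratedDeriv_le_of_forall_mem_sphere_norm_le m (by linarith) ?_ ?_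
  · exact (hΦ.mono ((closure_ball_subset_closedBall).trans hsub)).diffContOnCl
  · exact fun z hz => hB z (hsub (sphere_subset_closedBall hz))

variable {E : Type*} [NormedAddCommGroup E] [InnerProductSpace ℝ E] [CompleteSpace E]

/-- On `S`, the restrictions of `f` to lines extend to discs of radius `r` in the complex plane, as
holomorphic functions bounded by `B`. -/
def HasHolomorphicSlices (f : E → ℝ) (B r : ℝ) (S : Set E) : Prop :=
  ∀ p ∈ S, ∀ q : E, ‖q‖ = 1 → ∃ Φ : ℂ → ℂ, DifferentiableOn ℂ Φ (ball 0 r) ∧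
    (∀ z ∈ ball (0 : ℂ) r, ‖Φ z‖ ≤ B) ∧ ∀ t : ℝ, |t| < r → f (p + t • q) = (Φ t).re

theorem inner_gradient_eq_fderiv (f : E → ℝ) (p v : E) :
    inner ℝ (gradient f p) v = fderiv ℝ f p v := by
  simp [gradient]

theorem hasDerivAt_clm_apply_comp_line {E G F : Type*} [NormedAddCommGroup E] [NormedSpace ℝ E]
    [NormedAddCommGroup G] [NormedSpace ℝ G] [NormedAddCommGroup F] [NormedSpace ℝ F]
    {A : E → G →L[ℝ] F} {p d : E} {t : ℝ} (hA : DifferentiableAt ℝ A (p + t • d)) (u : G) :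
    HasDerivAt (fun s : ℝ => A (p + s • d) u) (fderiv ℝ A (p + t • d) d u) t := by
  have h1 : HasDerivAt (fun s : ℝ => p + s • d) d t := by
    simpa using ((hasDerivAt_id t).smul_const d).const_add p
  have h2 : HasDerivAt (fun s : ℝ => A (p + s • d)) (fderiv ℝ A (p + t • d) d) t :=
    hA.hasFDerivAt.comp_hasDerivAt t h1
  exact (ContinuousLinearMap.apply ℝ F u).hasFDerivAt.comp_hasDerivAt t h2

section ContDiff

variable {f : E → ℝ} {U : Set E} {p : E}

theorem ContDiffOn.gradient_of_isOpen {m n : ℕ∞} (hf : ContDiffOn ℝ n f U) (hU : IsOpen U)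
    (hmn : m + 1 ≤ n) : ContDiffOn ℝ m (gradient f) U :=
  (InnerProductSpace.toDual ℝ E).symm.contDiff.comp_contDiffOn
    (hf.fderiv_of_isOpen hU (by exact_mod_cast hmn))

theorem ContDiffOn.hessian_of_isOpen {m n : ℕ∞} (hf : ContDiffOn ℝ n f U) (hU : IsOpen U)
    (hmn : m + 1 + 1 ≤ n) : ContDiffOn ℝ m (hessian f) U :=
  (hf.gradient_of_isOpen hU hmn).fderiv_of_isOpen hU le_rfl

theorem inner_hessian_comm (hf : ContDiffAt ℝ 2 f p) (v w : E) :
    inner ℝ (hessian f p v) w = inner ℝ v (hessian f p w) := by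
  have h1 : ∀ a b : E, inner ℝ (hessian f p a) b = fderiv ℝ (fderiv ℝ f) p a b := by
    intro a b
    have hd : DifferentiableAt ℝ (fderiv ℝ f) p :=
      (hf.fderiv_right (m := 1) (by norm_num)).differentiableAt (by norm_num)
    have hg : DifferentiableAt ℝ (gradient f) (p + (0 : ℝ) • a) := by
      rw [zero_smul, add_zero]
      exact (InnerProductSpace.toDual ℝ E).symm.differentiable.differentiableAt.comp p hd
    have h2 := hasDerivAt_inner_gradient_comp_line (u := b) hg
    rw [← add_zero p, ← zero_smul ℝ a] at hd
    have h4 := hasDerivAt_clm_apply_comp_line hd b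
    simp only [inner_gradient_eq_fderiv] at h2
    have h5 := h2.unique h4
    simpa using h5
  rw [real_inner_comm, real_inner_comm, h1, real_inner_comm, h1]
  exact (hf.isSymmSndFDerivAt (by simp)).eq v w

theorem isSymmetric_hessian (hf : ContDiffAt ℝ 2 f p) :
    (hessian f p : E →ₗ[ℝ] E).IsSymmetric :=
  fun v w => inner_hessian_comm hf v w

theorem hasDerivAt_inner_hessian_comp_line {d u w : E} {t : ℝ}
    (hg : DifferentiableAt ℝ (hessian f) (p + t • d)) :
    HasDerivAt (fun s : ℝ => inner ℝ (hessian f (p + s • d) u) w)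
      (inner ℝ (fderiv ℝ (hessian f) (p + t • d) d u) w) t := by
  have h2 := hasDerivAt_clm_apply_comp_line hg u
  have h4 := h2.inner ℝ (hasDerivAt_const t w)
  rw [inner_zero_right, zero_add] at h4
  exact h4

/-- Differentiate the symmetry of the Hessian along a line. With `fderiv_hessian_comm`, this makes
the third derivative a fully symmetric trilinear form. -/
theorem inner_fderiv_hessian_comm (hU : IsOpen U) (hf : ContDiffOn ℝ 3 f U) (hp : p ∈ U)
    (a u w : E) : inner ℝ (fderiv ℝ (hessian f) p a u) w
      = inner ℝ u (fderiv ℝ (hessian f) p a w) := by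
  have hd : DifferentiableAt ℝ (hessian f) (p + (0 : ℝ) • a) := by
    rw [zero_smul, add_zero]
    exact ((hf.hessian_of_isOpen (m := 1) (n := 3) hU (by norm_num)).differentiableOn
      (by norm_num)).differentiableAt (hU.mem_nhds hp)
  have h1 := hasDerivAt_inner_hessian_comp_line (u := u) (w := w) hd
  have h2 := hasDerivAt_inner_hessian_comp_line (u := w) (w := u) hd
  rw [zero_smul, add_zero] at h1 h2
  rw [real_inner_comm _ u]
  refine h1.unique (h2.congr_of_eventuallyEq ?_)
  have hc : Filter.Tendsto (fun s : ℝ => p + s • a) (nhds 0) (nhds p) := by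
    have : Continuous fun s : ℝ => p + s • a := by fun_prop
    simpa using this.tendsto 0
  filter_upwards [hc.eventually (hU.mem_nhds hp)] with s hs
  rw [inner_hessian_comm ((hf.contDiffAt (hU.mem_nhds hs)).of_le (by norm_num)), real_inner_comm]

theorem fderiv_hessian_comm (hU : IsOpen U) (hf : ContDiffOn ℝ 3 f U) (hp : p ∈ U)
    (a u : E) : fderiv ℝ (hessian f) p a u = fderiv ℝ (hessian f) p u a := by
  have h1 : ContDiffAt ℝ 2 (gradient f) p :=
    (hf.gradient_of_isOpen (m := 2) (n := 3) hU (by norm_num)).contDiffAt (hU.mem_nhds hp)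
  exact (h1.isSymmSndFDerivAt (by simp)).eq a u

end ContDiff

/-- The derivatives of `t ↦ f (p + t • q)` up to order three. -/
noncomputable def sliceDeriv (f : E → ℝ) (p q : E) : ℕ → ℝ → ℝ
  | 0, t => f (p + t • q)
  | 1, t => inner ℝ (gradient f (p + t • q)) q
  | 2, t => inner ℝ (hessian f (p + t • q) q) q
  | _, t => inner ℝ (fderiv ℝ (hessian f) (p + t • q) q q) q

theorem hasDerivAt_sliceDeriv {f : E → ℝ} {U : Set E} {p q : E} (hU : IsOpen U)
    (hf : ContDiffOn ℝ 3 f U) {t : ℝ} (ht : p + t • q ∈ U) {m : ℕ} (hm : m < 3) :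
    HasDerivAt (sliceDeriv f p q m) (sliceDeriv f p q (m + 1) t) t := by
  have hmem := hU.mem_nhds ht
  interval_cases m
  · exact hasDerivAt_comp_line ((hf.differentiableOn (by norm_num)).differentiableAt hmem)
  · exact hasDerivAt_inner_gradient_comp_line
      (((hf.gradient_of_isOpen (m := 2) (n := 3) hU (by norm_num)).differentiableOn
        (by norm_num)).differentiableAt hmem)
  · exact hasDerivAt_inner_hessian_comp_line
      (((hf.hessian_of_isOpen (m := 1) (n := 3) hU (by norm_num)).differentiableOn
        (by norm_num)).differentiableAt hmem)

-- The norm of a symmetric operator is the supremum of its Rayleigh quotients in absolute value, so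
-- bounds on pure second directional derivatives suffice.
omit [CompleteSpace E] in
theorem norm_le_of_abs_inner_le {T : E →L[ℝ] E} (hT : (T : E →ₗ[ℝ] E).IsSymmetric) {c : ℝ}
    (hc : ∀ x, ‖x‖ = 1 → |inner ℝ (T x) x| ≤ c) (hc0 : 0 ≤ c) : ‖T‖ ≤ c := by
  rw [T.norm_eq_iSup_rayleighQuotient hT]
  refine ciSup_le fun x => ?_
  rcases eq_or_ne x 0 with rfl | hx
  · simpa using hc0
  have hx' : ‖x‖ ≠ 0 := norm_ne_zero_iff.2 hx
  have := hc (‖x‖⁻¹ • x) (by rw [norm_smul, norm_inv, norm_norm, inv_mul_cancel₀ hx'])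
  rw [map_smul, inner_smul_left, inner_smul_right] at this
  simp only [ContinuousLinearMap.rayleighQuotient, ContinuousLinearMap.reApplyInnerSelf_apply]
  convert! this using 2
  simp
  field_simp

namespace HasHolomorphicSlices

variable {f : E → ℝ} {B r : ℝ} {S U : Set E} {p : E}

theorem derivative_bounds (h : HasHolomorphicSlices f B r S) (hr : 0 < r)
    (hU : IsOpen U) (hf : ContDiffOn ℝ 3 f U)
    (hSU : ∀ p ∈ S, ∀ q : E, ‖q‖ < r → p + q ∈ U) (hp : p ∈ S) {q : E} (hq : ‖q‖ = 1) :
    |inner ℝ (gradient f p) q| ≤ 2 * B / r ∧ |inner ℝ (hessian f p q) q| ≤ 8 * B / r ^ 2 ∧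
      |inner ℝ (fderiv ℝ (hessian f) p q q) q| ≤ 48 * B / r ^ 3 := by
  obtain ⟨Φ, hΦ, hB, h0⟩ := h p hp q hq
  have he : ∀ m < 3, ∀ t : ℝ, |t| < r →
      HasDerivAt (sliceDeriv f p q m) (sliceDeriv f p q (m + 1) t) t := fun m hm t ht =>
    hasDerivAt_sliceDeriv hU hf
      (hSU p hp _ (by rw [norm_smul, hq, mul_one]; exact ht)) hm
  have key := fun m hm => abs_le_of_slice hr hΦ hB he h0 (m := m) hm
  have k1 := key 1 (by norm_num)
  have k2 := key 2 (by norm_num)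
  have k3 := key 3 (by norm_num)
  simp only [sliceDeriv, zero_smul, add_zero] at k1 k2 k3
  refine ⟨k1.trans_eq ?_, k2.trans_eq ?_, k3.trans_eq ?_⟩ <;> simp [Nat.factorial] <;> field_simp
    <;> ring

theorem norm_gradient_le (h : HasHolomorphicSlices f B r S) (hr : 0 < r) (hB : 0 ≤ B)
    (hU : IsOpen U) (hf : ContDiffOn ℝ 3 f U)
    (hSU : ∀ p ∈ S, ∀ q : E, ‖q‖ < r → p + q ∈ U) (hp : p ∈ S) :
    ‖gradient f p‖ ≤ 2 * B / r := by
  rcases eq_or_ne (gradient f p) 0 with h0 | h0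
  · rw [h0, norm_zero]; positivity
  have h0' := norm_ne_zero_iff.2 h0
  have := (h.derivative_bounds hr hU hf hSU hp (q := ‖gradient f p‖⁻¹ • gradient f p)
    (by rw [norm_smul, norm_inv, norm_norm, inv_mul_cancel₀ h0'])).1
  rw [inner_smul_right, real_inner_self_eq_norm_sq, sq, inv_mul_cancel_left₀ h0', abs_norm] at this
  exact this

theorem norm_hessian_le (h : HasHolomorphicSlices f B r S) (hr : 0 < r) (hB : 0 ≤ B)
    (hU : IsOpen U) (hf : ContDiffOn ℝ 3 f U)
    (hSU : ∀ p ∈ S, ∀ q : E, ‖q‖ < r → p + q ∈ U) (hp : p ∈ S) :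
    ‖hessian f p‖ ≤ 8 * B / r ^ 2 := by
  have hpU : p ∈ U := by simpa using hSU p hp 0 (by simpa using hr)
  exact norm_le_of_abs_inner_le
    (isSymmetric_hessian ((hf.contDiffAt (hU.mem_nhds hpU)).of_le (by norm_num)))
    (fun x hx => (h.derivative_bounds hr hU hf hSU hp hx).2.1) (by positivity)

/-- Cauchy bounds only the cubic form `D(q, q, q)`, by `48 B / r³`; polarization recovers the
trilinear form and loses a factor 3. -/
theorem norm_fderiv_hessian_le (h : HasHolomorphicSlices f B r S) (hr : 0 < r) (hB : 0 ≤ B)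
    (hU : IsOpen U) (hf : ContDiffOn ℝ 3 f U)
    (hSU : ∀ p ∈ S, ∀ q : E, ‖q‖ < r → p + q ∈ U) (hp : p ∈ S) :
    ‖fderiv ℝ (hessian f) p‖ ≤ 144 * B / r ^ 3 := by
  have hpU : p ∈ U := by simpa using hSU p hp 0 (by simpa using hr)
  set C := 48 * B / r ^ 3 with hC
  have hC0 : 0 ≤ C := by positivity
  set D := fderiv ℝ (hessian f) p with hD
  have hcub : ∀ x : E, |inner ℝ (D x x) x| ≤ C * ‖x‖ ^ 3 := by
    intro x
    rcases eq_or_ne x 0 with rfl | hx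
    · simp
    have hx' : ‖x‖ ≠ 0 := norm_ne_zero_iff.2 hx
    have := (h.derivative_bounds hr hU hf hSU hp (q := ‖x‖⁻¹ • x)
      (by rw [norm_smul, norm_inv, norm_norm, inv_mul_cancel₀ hx'])).2.2
    rw [← hD, ← hC] at this
    simp only [map_smul, smul_apply, inner_smul_left, inner_smul_right, conj_trivial,
      abs_mul, abs_inv, abs_norm] at this
    field_simp at this
    linarith
  have hunit : ∀ w : E, ‖w‖ = 1 → ‖D w‖ ≤ 3 * C := by
    intro w hw
    refine norm_le_of_abs_inner_le (fun u v => inner_fderiv_hessian_comm hU hf hpU w u v) ?_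
      (by positivity)
    intro q hq
    have c1 : D q w = D w q := fderiv_hessian_comm hU hf hpU q w
    have c2 : inner ℝ (D q q) w = inner ℝ (D w q) q := by
      rw [inner_fderiv_hessian_comm hU hf hpU, real_inner_comm, ← hD, c1]
    have c3 : inner ℝ (D w w) q = inner ℝ (D q w) w := by
      rw [inner_fderiv_hessian_comm hU hf hpU, real_inner_comm, ← hD, c1]
    -- `D(q+w)³ - D(q-w)³ = 6 D(q,q,w) + 2 D(w,w,w)`, hence `6 |D(q,q,w)| ≤ 8C + 8C + 2C`.
    have e1 := hcub (q + w)
    have e2 := hcub (q - w)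
    have e3 := hcub w
    have n1 : ‖q + w‖ ^ 3 ≤ 2 ^ 3 := by
      gcongr; exact (norm_add_le _ _).trans (by rw [hq, hw]; norm_num)
    have n2 : ‖q - w‖ ^ 3 ≤ 2 ^ 3 := by
      gcongr; exact (norm_sub_le _ _).trans (by rw [hq, hw]; norm_num)
    replace e1 := e1.trans (mul_le_mul_of_nonneg_left n1 hC0)
    replace e2 := e2.trans (mul_le_mul_of_nonneg_left n2 hC0)
    rw [hw] at e3
    simp only [map_add, map_sub, add_apply, sub_apply, inner_add_left, inner_add_right,
      inner_sub_left, inner_sub_right, c1, c2, c3] at e1 e2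
    rw [abs_le] at *
    constructor <;> linarith [e1.1, e1.2, e2.1, e2.2, e3.1, e3.2]
  refine ContinuousLinearMap.opNorm_le_bound _ (by positivity) fun w => ?_
  rcases eq_or_ne w 0 with rfl | hx
  · simp
  have hx' : ‖w‖ ≠ 0 := norm_ne_zero_iff.2 hx
  have := hunit (‖w‖⁻¹ • w) (by rw [norm_smul, norm_inv, norm_norm, inv_mul_cancel₀ hx'])
  rw [map_smul, norm_smul, norm_inv, norm_norm, inv_mul_le_iff₀ (by positivity)] at this
  refine this.trans_eq ?_
  rw [hC]; ring

theorem isSmoothOn (h : HasHolomorphicSlices f B r S) (hr : 0 < r) (hB : 0 ≤ B)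
    (hU : IsOpen U) (hf : ContDiffOn ℝ 3 f U)
    (hSU : ∀ p ∈ S, ∀ q : E, ‖q‖ < r → p + q ∈ U) (hS : Convex ℝ S) :
    IsSmoothOn f (8 * B / r ^ 2) S := by
  have hpU : ∀ p ∈ S, U ∈ nhds p := fun p hp =>
    hU.mem_nhds (by simpa using hSU p hp 0 (by simpa using hr))
  refine ⟨fun p hp => (hf.differentiableOn (by norm_num)).differentiableAt (hpU p hp),
    fun p hp q hq => hS.norm_image_sub_le_of_norm_hasFDerivWithin_le (f' := hessian f)
      (fun x hx => ?_) (fun x hx => h.norm_hessian_le hr hB hU hf hSU hx) hq hp⟩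
  exact (((hf.gradient_of_isOpen (m := 2) (n := 3) hU (by norm_num)).differentiableOn
    (by norm_num)).differentiableAt (hpU x hx)).hasFDerivAt.hasFDerivWithinAt

theorem isHessianLipschitzOn (h : HasHolomorphicSlices f B r S) (hr : 0 < r) (hB : 0 ≤ B)
    (hU : IsOpen U) (hf : ContDiffOn ℝ 3 f U)
    (hSU : ∀ p ∈ S, ∀ q : E, ‖q‖ < r → p + q ∈ U) (hS : Convex ℝ S) :
    IsHessianLipschitzOn f (144 * B / r ^ 3) S := by
  have hpU : ∀ p ∈ S, U ∈ nhds p := fun p hp =>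
    hU.mem_nhds (by simpa using hSU p hp 0 (by simpa using hr))
  refine ⟨fun p hp => ⟨(hf.differentiableOn (by norm_num)).differentiableAt (hpU p hp),
    ((hf.gradient_of_isOpen (m := 2) (n := 3) hU (by norm_num)).differentiableOn
    (by norm_num)).differentiableAt (hpU p hp)⟩,
    fun p hp q hq => hS.norm_image_sub_le_of_norm_hasFDerivWithin_le
      (f' := fderiv ℝ (hessian f))
      (fun x hx => ?_) (fun x hx => h.norm_fderiv_hessian_le hr hB hU hf hSU hx) hq hp⟩
  exact (((hf.hessian_of_isOpen (m := 1) (n := 3) hU (by norm_num)).differentiableOn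
    (by norm_num)).differentiableAt (hpU x hx)).hasFDerivAt.hasFDerivWithinAt

end HasHolomorphicSlices

end HolomorphicSlices

/-! ### The density of a Gaussian matrix. -/

section Density

theorem pi_withDensity_ofReal {ι α : Type*} [Fintype ι] [MeasurableSpace α]
    (μ : ι → Measure α) [∀ i, SigmaFinite (μ i)] {f : ι → α → ℝ}
    (hf : ∀ i, Integrable (f i) (μ i)) (h0 : ∀ i x, 0 ≤ f i x) :
    Measure.pi (fun i => (μ i).withDensity fun x => ENNReal.ofReal (f i x)) =
      (Measure.pi μ).withDensity fun x => ENNReal.ofReal (∏ i, f i (x i)) := by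
  have := fun i => isFiniteMeasure_withDensity_ofReal (hf i).hasFiniteIntegral
  refine Measure.pi_eq fun s hs => ?_
  have hr : ∀ i, Integrable (f i) ((μ i).restrict (s i)) := fun i => (hf i).restrict
  rw [withDensity_apply _ (MeasurableSet.univ_pi hs), Measure.restrict_pi_pi,
    ← ofReal_integral_eq_lintegral_ofReal (Integrable.fintype_prod hr)
      (.of_forall fun x => Finset.prod_nonneg fun i _ => h0 i _),
    integral_fintype_prod_eq_prod,
    ENNReal.ofReal_prod_of_nonneg fun i _ => integral_nonneg fun x => h0 i x]
  refine Finset.prod_congr rfl fun i _ => ?_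
  rw [withDensity_apply _ (hs i), ← ofReal_integral_eq_lintegral_ofReal (hr i)
    (.of_forall (h0 i))]

variable {k d : ℕ}

instance isProbabilityMeasure_gaussianMatrix (M : Matrix (Fin k) (Fin d) ℝ) (v : ℝ) :
    IsProbabilityMeasure (gaussianMatrix M v) := by
  have h : ∀ i, IsProbabilityMeasure (Measure.pi fun j => gaussianReal (M i j) v.toNNReal) :=
    fun i => inferInstance
  exact Measure.pi.instIsProbabilityMeasure _

/-- The density of `N(M, v)` with respect to Lebesgue measure. -/
noncomputable def gaussianMatrixDensity (M : Matrix (Fin k) (Fin d) ℝ) (v : ℝ)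
    (a : Fin k → Fin d → ℝ) : ℝ :=
  Real.exp (∑ i, ∑ j, (-(1 / 2 * Real.log (2 * Real.pi * v)) - (a i j - M i j) ^ 2 / (2 * v)))

theorem gaussianPDFReal_eq_exp {v : ℝ} (hv : 0 < v) (m x : ℝ) :
    gaussianPDFReal m v.toNNReal x
      = Real.exp (-(1 / 2 * Real.log (2 * Real.pi * v)) - (x - m) ^ 2 / (2 * v)) := by
  have hpos : 0 < 2 * Real.pi * v := by positivity
  rw [gaussianPDFReal, Real.coe_toNNReal _ hv.le,
    sub_eq_add_neg (-(1 / 2 * Real.log (2 * Real.pi * v))), Real.exp_add, Real.exp_neg, neg_div]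
  congr 2
  rw [one_div_mul_eq_div, Real.exp_half, Real.exp_log hpos]

theorem pi_gaussianReal_eq_withDensity {ι : Type*} [Fintype ι] (m : ι → ℝ) {v : ℝ} (hv : 0 < v) :
    Measure.pi (fun j => gaussianReal (m j) v.toNNReal) =
      (volume : Measure (ι → ℝ)).withDensity
        fun x => ENNReal.ofReal (∏ j, gaussianPDFReal (m j) v.toNNReal (x j)) := by
  have hv' : v.toNNReal ≠ 0 := by simpa using hv
  rw [volume_pi, ← pi_withDensity_ofReal _ (fun j => integrable_gaussianPDFReal _ _)
    (fun j x => gaussianPDFReal_nonneg _ _ _)]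
  congr 1
  funext j
  rw [gaussianReal_of_var_ne_zero _ hv']
  rfl

theorem gaussianMatrix_eq_withDensity (M : Matrix (Fin k) (Fin d) ℝ) {v : ℝ} (hv : 0 < v) :
    gaussianMatrix M v
      = volume.withDensity fun a => ENNReal.ofReal (gaussianMatrixDensity M v a) := by
  have h1 : gaussianMatrix M v = Measure.pi fun i => (volume : Measure (Fin d → ℝ)).withDensity
      fun x => ENNReal.ofReal (∏ j, gaussianPDFReal (M i j) v.toNNReal (x j)) :=
    congrArg _ (funext fun i => pi_gaussianReal_eq_withDensity (M i) hv)
  have h2 : ∀ i, Integrable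
      (fun x : Fin d → ℝ => ∏ j, gaussianPDFReal (M i j) v.toNNReal (x j)) :=
    fun i => Integrable.fintype_prod fun j => integrable_gaussianPDFReal _ _
  have h3 : ∀ i (x : Fin d → ℝ), 0 ≤ ∏ j, gaussianPDFReal (M i j) v.toNNReal (x j) :=
    fun i x => Finset.prod_nonneg fun j _ => gaussianPDFReal_nonneg _ _ _
  rw [h1, pi_withDensity_ofReal (fun _ => volume) h2 h3, ← volume_pi]
  congr 1
  funext a
  simp_rw [gaussianPDFReal_eq_exp hv, ← Real.exp_sum]
  rfl

theorem gaussianMatrixDensity_nonneg (M : Matrix (Fin k) (Fin d) ℝ) (v : ℝ)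
    (a : Fin k → Fin d → ℝ) : 0 ≤ gaussianMatrixDensity M v a := (Real.exp_pos _).le

theorem measurable_gaussianMatrixDensity (M : Matrix (Fin k) (Fin d) ℝ) (v : ℝ) :
    Measurable (gaussianMatrixDensity M v) := by
  unfold gaussianMatrixDensity
  fun_prop

theorem integral_gaussianMatrix (M : Matrix (Fin k) (Fin d) ℝ) {v : ℝ} (hv : 0 < v)
    (φ : (Fin k → Fin d → ℝ) → ℝ) :
    ∫ a, φ a ∂gaussianMatrix M v = ∫ a, gaussianMatrixDensity M v a * φ a := by
  rw [gaussianMatrix_eq_withDensity M hv, integral_withDensity_eq_integral_toReal_smul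
    (measurable_gaussianMatrixDensity M v).ennreal_ofReal (.of_forall fun _ => ENNReal.ofReal_lt_top)]
  simp_rw [ENNReal.toReal_ofReal (gaussianMatrixDensity_nonneg M v _), smul_eq_mul]

end Density

/-! ### Smoothness of exponential families. -/

section ExponentialFamily

/-- Each differentiation brings down a factor `‖T‖`; this absorbs it into half of the exponential
slack `δ`. -/
theorem mul_exp_le_exp {δ x : ℝ} (hδ : 0 < δ) : x ≤ 2 / δ * Real.exp (δ / 2 * x) := by
  have h := Real.add_one_le_exp (δ / 2 * x)
  have : x = 2 / δ * (δ / 2 * x) := by field_simp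
  calc x = 2 / δ * (δ / 2 * x) := this
    _ ≤ _ := by gcongr; linarith

section

variable {Ω E F : Type*} [MeasurableSpace Ω] {μ : Measure Ω} [NormedAddCommGroup E]
  [InnerProductSpace ℝ E] [NormedAddCommGroup F] [NormedSpace ℝ F]
  {T : Ω → E} {h : Ω → F} {η : E} {δ : ℝ}

omit [NormedSpace ℝ F] in
theorem integrable_exp_inner_mul_norm_mul_norm (hT : AEStronglyMeasurable T μ)
    (hh : AEStronglyMeasurable h μ) (hδ : 0 < δ)
    (hint : Integrable (fun a => Real.exp (inner ℝ (T a) η + δ * ‖T a‖) * ‖h a‖) μ) :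
    Integrable (fun a => Real.exp (inner ℝ (T a) η + δ / 2 * ‖T a‖) * (‖T a‖ * ‖h a‖)) μ := by
  refine (hint.const_mul (2 / δ)).mono' ?_ (.of_forall fun a => ?_)
  · exact (Real.continuous_exp.comp_aestronglyMeasurable
      ((hT.inner aestronglyMeasurable_const).add (hT.norm.const_mul _))).mul (hT.norm.mul hh.norm)
  · rw [Real.norm_of_nonneg (by positivity)]
    calc Real.exp (inner ℝ (T a) η + δ / 2 * ‖T a‖) * (‖T a‖ * ‖h a‖)
        ≤ Real.exp (inner ℝ (T a) η + δ / 2 * ‖T a‖) *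
          ((2 / δ * Real.exp (δ / 2 * ‖T a‖)) * ‖h a‖) := by
          gcongr; exact mul_exp_le_exp hδ
      _ = 2 / δ * ((Real.exp (inner ℝ (T a) η + δ / 2 * ‖T a‖) * Real.exp (δ / 2 * ‖T a‖))
          * ‖h a‖) := by ring
      _ = _ := by rw [← Real.exp_add]; ring_nf

theorem hasFDerivAt_integral_exp_inner (hT : AEStronglyMeasurable T μ)
    (hh : AEStronglyMeasurable h μ) (hδ : 0 < δ)
    (hint : Integrable (fun a => Real.exp (inner ℝ (T a) η + δ * ‖T a‖) * ‖h a‖) μ) :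
    HasFDerivAt (fun η => ∫ a, Real.exp (inner ℝ (T a) η) • h a ∂μ)
      (∫ a, Real.exp (inner ℝ (T a) η) • (innerSL ℝ (T a)).smulRight (h a) ∂μ) η := by
  have hexp : ∀ η, AEStronglyMeasurable (fun a => Real.exp (inner ℝ (T a) η)) μ := fun η =>
    Real.continuous_exp.comp_aestronglyMeasurable (hT.inner aestronglyMeasurable_const)
  have hsm : AEStronglyMeasurable (fun a => (innerSL ℝ (T a)).smulRight (h a)) μ := by
    have hc : Continuous fun p : E × F => (innerSL ℝ p.1).smulRight p.2 := by fun_prop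
    exact hc.comp_aestronglyMeasurable (hT.prodMk hh)
  refine hasFDerivAt_integral_of_dominated_of_fderiv_le
    (F' := fun η a => Real.exp (inner ℝ (T a) η) • (innerSL ℝ (T a)).smulRight (h a))
    (Metric.ball_mem_nhds η (half_pos hδ))
    (.of_forall fun η => (hexp η).smul hh) ?_ ((hexp η).smul hsm)
    (.of_forall fun a η' hη' => ?_)
    (integrable_exp_inner_mul_norm_mul_norm hT hh hδ hint) (.of_forall fun a η' _ => ?_)
  · refine hint.mono' ((hexp η).smul hh) (.of_forall fun a => ?_)
    rw [norm_smul, Real.norm_of_nonneg (Real.exp_pos _).le]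
    gcongr
    have := norm_nonneg (T a)
    nlinarith
  · rw [norm_smul, Real.norm_of_nonneg (Real.exp_pos _).le,
      ContinuousLinearMap.norm_smulRight_apply, innerSL_apply_norm]
    gcongr
    have h1 := real_inner_le_norm (T a) (η' - η)
    rw [inner_sub_right] at h1
    have h2 : ‖η' - η‖ ≤ δ / 2 := by
      rw [← dist_eq_norm]; exact (Metric.mem_ball.1 hη').le
    nlinarith [mul_le_mul_of_nonneg_left h2 (norm_nonneg (T a))]
  · have h1 : HasFDerivAt (fun η => Real.exp (inner ℝ (T a) η))
        (Real.exp (inner ℝ (T a) η') • innerSL ℝ (T a)) η' :=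
      ((innerSL ℝ (T a)).hasFDerivAt (x := η')).exp
    have h2 := h1.smul_const (h a)
    convert h2 using 1
    ext x
    simp [mul_smul]

end

/-- The derivative is an integral of the same form with the weight `h` replaced by `T ⊗ h`, so
induction works once the target space `F` is allowed to vary. -/
theorem contDiffOn_integral_exp_inner {Ω E : Type} [MeasurableSpace Ω] {μ : Measure Ω}
    [NormedAddCommGroup E] [InnerProductSpace ℝ E] {T : Ω → E} (hT : AEStronglyMeasurable T μ)
    {U : Set E} (hU : IsOpen U) (n : ℕ) :
    ∀ {F : Type} [NormedAddCommGroup F] [NormedSpace ℝ F] {h : Ω → F},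
      AEStronglyMeasurable h μ →
      (∀ η ∈ U, ∃ δ > 0,
        Integrable (fun a => Real.exp (inner ℝ (T a) η + δ * ‖T a‖) * ‖h a‖) μ) →
      ContDiffOn ℝ n (fun η => ∫ a, Real.exp (inner ℝ (T a) η) • h a ∂μ) U := by
  induction n with
  | zero =>
    intro F _ _ h hh hint
    refine contDiffOn_zero.2 fun η hη => ?_
    obtain ⟨δ, hδ, hi⟩ := hint η hη
    exact (hasFDerivAt_integral_exp_inner hT hh hδ hi).continuousAt.continuousWithinAt
  | succ n ih =>
    intro F _ _ h hh hint
    have hsm : AEStronglyMeasurable (fun a => (innerSL ℝ (T a)).smulRight (h a)) μ := by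
      have hc : Continuous fun p : E × F => (innerSL ℝ p.1).smulRight p.2 := by fun_prop
      exact hc.comp_aestronglyMeasurable (hT.prodMk hh)
    rw [Nat.cast_add, Nat.cast_one, contDiffOn_succ_iff_hasFDerivWithinAt_of_uniqueDiffOn
      hU.uniqueDiffOn]
    refine ⟨fun h => absurd h (by simp), _, ih hsm fun η hη => ?_, fun η hη => ?_⟩
    · obtain ⟨δ, hδ, hi⟩ := hint η hη
      refine ⟨δ / 2, half_pos hδ, ?_⟩
      simp only [ContinuousLinearMap.norm_smulRight_apply, innerSL_apply_norm]
      exact integrable_exp_inner_mul_norm_mul_norm hT hh hδ hi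
    · obtain ⟨δ, hδ, hi⟩ := hint η hη
      exact (hasFDerivAt_integral_exp_inner hT hh hδ hi).hasFDerivWithinAt

end ExponentialFamily

/-! ### Gaussian averages of bounded functions are smooth for positive variance. -/

section GaussianAverage

variable {k d : ℕ}

/-- The average of `φ` under `N(M, v)`, as a function of `(M, v)`. -/
noncomputable def gaussianAverage (φ : (Fin k → Fin d → ℝ) → ℝ) (p : Param k d) : ℝ :=
  ∫ a, φ a ∂gaussianMatrix p.mean p.var

/-- The natural sufficient statistic of the Gaussian family. -/
noncomputable def gaussianStatistic (a : Fin k → Fin d → ℝ) : Param k d :=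
  Param.mk (Matrix.of a) (∑ i, ∑ j, a i j ^ 2)

theorem Param.inner_mk (A : Matrix (Fin k) (Fin d) ℝ) (v : ℝ) (p : Param k d) :
    inner ℝ (Param.mk A v) p = ∑ i, ∑ j, A i j * p.mean i j + v * p.var := by
  simp [Param.mk, PiLp.inner_apply, Fintype.sum_sum_type, Fintype.sum_prod_type, Param.mean,
    Param.var, mul_comm]

theorem Param.norm_mk_le (A : Matrix (Fin k) (Fin d) ℝ) (v : ℝ) :
    ‖Param.mk A v‖ ≤ ∑ i, ∑ j, |A i j| + |v| := by
  have h := (EuclideanSpace.basisFun ((Fin k × Fin d) ⊕ Unit) ℝ).sum_repr (Param.mk A v)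
  rw [← h]
  refine (norm_sum_le _ _).trans_eq ?_
  simp [norm_smul, Fintype.sum_sum_type, Fintype.sum_prod_type, Param.mk]

theorem measurable_gaussianStatistic :
    Measurable (gaussianStatistic : (Fin k → Fin d → ℝ) → Param k d) := by
  refine (WithLp.measurable_toLp 2 _).comp (measurable_pi_lambda _ ?_)
  rintro (⟨i, j⟩ | ⟨⟩)
  · simp only [Sum.elim_inl, Matrix.of_apply]; fun_prop
  · simp only [Sum.elim_inr]; fun_prop

theorem integrable_exp_quadratic_abs {c : ℝ} (hc : 0 < c) (θ δ : ℝ) :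
    Integrable fun x : ℝ => Real.exp (θ * x + δ * |x| - c * x ^ 2) := by
  refine ((integrable_exp_neg_mul_sq (half_pos hc)).const_mul
    (Real.exp ((|θ| + |δ|) ^ 2 / (2 * c)))).mono' (by fun_prop) (.of_forall fun x => ?_)
  rw [Real.norm_of_nonneg (Real.exp_pos _).le, ← Real.exp_add]
  gcongr
  have h1 : θ * x ≤ |θ| * |x| := by rw [← abs_mul]; exact le_abs_self _
  have h2 : δ * |x| ≤ |δ| * |x| := by gcongr; exact le_abs_self _
  have h3 : 0 ≤ (|θ| + |δ| - c * |x|) ^ 2 / (2 * c) := by positivity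
  have h4 : (|θ| + |δ| - c * |x|) ^ 2 / (2 * c)
      = (|θ| + |δ|) ^ 2 / (2 * c) - (|θ| + |δ|) * |x| + c / 2 * x ^ 2 := by
    rw [← sq_abs x]; field_simp; ring
  nlinarith

theorem integrable_exp_sum_sum {f : Fin k → Fin d → ℝ → ℝ}
    (hf : ∀ i j, Integrable fun x : ℝ => Real.exp (f i j x)) :
    Integrable fun a : Fin k → Fin d → ℝ => Real.exp (∑ i, ∑ j, f i j (a i j)) := by
  simp_rw [Real.exp_sum]
  exact Integrable.fintype_prod (f := fun i (y : Fin d → ℝ) => ∏ j, Real.exp (f i j (y j)))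
    (μ := fun _ => volume) fun i => Integrable.fintype_prod fun j => hf i j

theorem integral_exp_sum_sum (f : Fin k → Fin d → ℝ → ℝ) :
    ∫ a : Fin k → Fin d → ℝ, Real.exp (∑ i, ∑ j, f i j (a i j))
      = ∏ i, ∏ j, ∫ x, Real.exp (f i j x) := by
  simp_rw [Real.exp_sum]
  rw [integral_fintype_prod_volume_eq_prod (fun i (y : Fin d → ℝ) => ∏ j, Real.exp (f i j (y j)))]
  refine Finset.prod_congr rfl fun i _ => ?_
  exact integral_fintype_prod_volume_eq_prod (fun j x => Real.exp (f i j x))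

/-- The statistic is quadratic, so `δ ‖T‖` competes with the Gaussian decay `-2δ ∑ a²`; the choice
`δ = -η.var / 2` spends half of that decay. -/
theorem integrable_exp_inner_gaussianStatistic {η : Param k d} (hη : η.var < 0)
    {φ : (Fin k → Fin d → ℝ) → ℝ} (hφ : Measurable φ) {C : ℝ} (hC : ∀ a, |φ a| ≤ C) :
    Integrable fun a => Real.exp (inner ℝ (gaussianStatistic a) η
      + (-η.var / 2) * ‖gaussianStatistic a‖) * ‖φ a‖ := by
  set δ := -η.var / 2 with hδ
  have hδ0 : 0 < δ := by rw [hδ]; linarith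
  refine ((integrable_exp_sum_sum (f := fun i j x => η.mean i j * x + δ * |x| - δ * x ^ 2)
    fun i j => integrable_exp_quadratic_abs hδ0 _ _).mul_const C).mono' ?_
    (.of_forall fun a => ?_)
  · have h1 := measurable_gaussianStatistic (k := k) (d := d)
    exact ((((h1.inner measurable_const).add (h1.norm.const_mul _)).exp).mul
      hφ.norm).aestronglyMeasurable
  · rw [Real.norm_of_nonneg (by positivity)]
    gcongr ?_ * ?_
    · gcongr
      have h1 := mul_le_mul_of_nonneg_left (Param.norm_mk_le (Matrix.of a) (∑ i, ∑ j, a i j ^ 2))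
        hδ0.le
      rw [abs_of_nonneg (by positivity)] at h1
      rw [gaussianStatistic, Param.inner_mk]
      have h2 : η.var = -2 * δ := by rw [hδ]; ring
      simp only [Finset.sum_sub_distrib, Finset.sum_add_distrib, ← Finset.mul_sum, mul_comm (η.mean _ _)]
      rw [h2]
      simp only [Matrix.of_apply] at h1 ⊢
      linarith
    · exact hC a

theorem gaussianMatrixDensity_eq_exp_inner (M : Matrix (Fin k) (Fin d) ℝ) {v : ℝ} (hv : 0 < v)
    (a : Fin k → Fin d → ℝ) :
    gaussianMatrixDensity M v a
      = Real.exp (∑ i, ∑ j, (-(1 / 2 * Real.log (2 * Real.pi * v)) - M i j ^ 2 / (2 * v)))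
        * Real.exp (inner ℝ (gaussianStatistic a) (Param.mk (v⁻¹ • M) (-(1 / (2 * v))))) := by
  rw [gaussianMatrixDensity, ← Real.exp_add, gaussianStatistic, Param.inner_mk, Param.var_mk]
  congr 1
  rw [Finset.sum_mul]
  simp_rw [Finset.sum_mul, ← Finset.sum_add_distrib]
  refine Finset.sum_congr rfl fun i _ => Finset.sum_congr rfl fun j _ => ?_
  simp only [Param.mean, Param.mk, Matrix.of_apply, Sum.elim_inl, Matrix.smul_apply, smul_eq_mul]
  field_simp
  ring

theorem isOpen_var_pos : IsOpen {p : Param k d | 0 < p.var} := by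
  have : Continuous (Param.var : Param k d → ℝ) := by unfold Param.var; fun_prop
  exact isOpen_lt continuous_const this

/-- In the natural parameters `(M/v, -1/(2v))` the average is an exponential integral times an
explicit normalizing factor, and both are smooth in `(M, v)`. -/
theorem contDiffOn_gaussianAverage {φ : (Fin k → Fin d → ℝ) → ℝ} (hφ : Measurable φ) {C : ℝ}
    (hC : ∀ a, |φ a| ≤ C) (n : ℕ) :
    ContDiffOn ℝ n (gaussianAverage φ) {p | 0 < p.var} := by
  have hneg : IsOpen {p : Param k d | p.var < 0} := by
    have : Continuous (Param.var : Param k d → ℝ) := by unfold Param.var; fun_prop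
    exact isOpen_lt this continuous_const
  have h1 := contDiffOn_integral_exp_inner
    (measurable_gaussianStatistic (k := k) (d := d)).aestronglyMeasurable hneg n
    hφ.aestronglyMeasurable (μ := volume)
    fun η hη => ⟨-η.var / 2, by have : η.var < 0 := hη; linarith,
      integrable_exp_inner_gaussianStatistic hη hφ hC⟩
  have hvar : ContDiffOn ℝ n (fun p : Param k d => p.var) {p | 0 < p.var} := by
    unfold Param.var; fun_prop
  have hmean : ∀ i j, ContDiffOn ℝ n (fun p : Param k d => p.mean i j) {p | 0 < p.var} := by
    intro i j
    simp only [Param.mean, Matrix.of_apply]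
    fun_prop
  have hpar : ContDiffOn ℝ n
      (fun p : Param k d => Param.mk (p.var⁻¹ • p.mean) (-(1 / (2 * p.var)))) {p | 0 < p.var} := by
    refine contDiffOn_euclidean.2 ?_
    rintro (⟨i, j⟩ | ⟨⟩)
    · simp only [Param.mk, Sum.elim_inl, Matrix.smul_apply, smul_eq_mul]
      exact (hvar.inv fun p hp => ne_of_gt hp).mul (hmean i j)
    · simp only [Param.mk, Sum.elim_inr]
      exact (contDiffOn_const.div (contDiffOn_const.mul hvar)
        fun p hp => mul_ne_zero two_ne_zero (ne_of_gt hp)).neg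
  have h2 := h1.comp hpar fun p hp => by
    have hp' : 0 < p.var := hp
    change -(1 / (2 * p.var)) < 0
    simp only [Left.neg_neg_iff]; positivity
  have h3 : ContDiffOn ℝ n (fun p : Param k d => Real.exp (∑ i, ∑ j,
      (-(1 / 2 * Real.log (2 * Real.pi * p.var)) - p.mean i j ^ 2 / (2 * p.var))))
      {p | 0 < p.var} := by
    refine ContDiffOn.exp (ContDiffOn.sum fun i _ => ContDiffOn.sum fun j _ => ?_)
    refine ContDiffOn.sub (ContDiffOn.neg (contDiffOn_const.mul (ContDiffOn.log
      (contDiffOn_const.mul hvar) fun p hp => ?_))) (((hmean i j).pow 2).div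
        (contDiffOn_const.mul hvar) fun p hp => mul_ne_zero two_ne_zero (ne_of_gt hp))
    exact mul_ne_zero (by positivity) (ne_of_gt hp)
  refine (h3.mul h2).congr fun p hp => ?_
  rw [gaussianAverage, integral_gaussianMatrix _ hp]
  simp_rw [gaussianMatrixDensity_eq_exp_inner _ hp, mul_assoc]
  rw [integral_const_mul]
  rfl

end GaussianAverage

/-! ### Differentiation under the integral for holomorphic kernels. -/

section HolomorphicIntegral

open Metric

variable {Ω : Type*} [MeasurableSpace Ω] {μ : Measure Ω} {K : ℂ → Ω → ℂ} {b : Ω → ℝ} {r : ℝ}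

/-- The derivative in the parameter is a limit of difference quotients along a sequence, and these
are measurable. -/
theorem aestronglyMeasurable_deriv_param {z : ℂ} (hz : z ∈ ball (0 : ℂ) r)
    (hK : ∀ a, DifferentiableOn ℂ (K · a) (ball 0 r))
    (hm : ∀ z ∈ ball (0 : ℂ) r, AEStronglyMeasurable (K z) μ) :
    AEStronglyMeasurable (fun a => deriv (K · a) z) μ := by
  obtain ⟨ε, hε, hsub⟩ := Metric.isOpen_iff.1 isOpen_ball z hz
  have hu : ∀ n : ℕ, z + ((ε / 2 / (n + 1) : ℝ) : ℂ) ∈ ball (0 : ℂ) r := fun n => by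
    apply hsub
    rw [mem_ball, dist_eq_norm, add_sub_cancel_left, Complex.norm_real, Real.norm_of_nonneg
      (by positivity)]
    calc ε / 2 / (n + 1) ≤ ε / 2 := div_le_self (by positivity) (by simp)
      _ < ε := by linarith
  refine aestronglyMeasurable_of_tendsto_ae Filter.atTop
    (f := fun (n : ℕ) a => slope (K · a) z (z + ((ε / 2 / (n + 1) : ℝ) : ℂ))) (fun n => ?_)
    (.of_forall fun a => ?_)
  · simp only [slope_def_module]
    exact ((hm _ (hu n)).sub (hm z hz)).const_smul ((z + ((ε / 2 / (n + 1) : ℝ) : ℂ) - z)⁻¹)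
  · have hd : HasDerivAt (K · a) (deriv (K · a) z) z :=
      ((hK a).differentiableAt (isOpen_ball.mem_nhds hz)).hasDerivAt
    refine hd.tendsto_slope.comp (tendsto_nhdsWithin_iff.2 ⟨?_, .of_forall fun n => ?_⟩)
    · have h1 : Filter.Tendsto (fun n : ℕ => ε / 2 / ((n : ℝ) + 1)) Filter.atTop (nhds 0) := by
        have := (tendsto_one_div_add_atTop_nhds_zero_nat (𝕜 := ℝ)).const_mul (ε / 2)
        simpa [div_eq_mul_inv] using this
      have h2 := ((Complex.continuous_ofReal.tendsto 0).comp h1).const_add z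
      simpa using h2
    · have : (0 : ℝ) < ε / 2 / ((n : ℝ) + 1) := by positivity
      simp only [Set.mem_compl_iff, Set.mem_singleton_iff, add_eq_left]
      exact_mod_cast this.ne'

theorem norm_deriv_le_div {f : ℂ → ℂ} {ρ B : ℝ} (hρ : 0 < ρ) {z : ℂ}
    (hz : ball z (2 * ρ) ⊆ ball 0 r) (hf : DifferentiableOn ℂ f (ball 0 r))
    (hB : ∀ z ∈ ball (0 : ℂ) r, ‖f z‖ ≤ B) : ‖deriv f z‖ ≤ B / ρ := by
  have hsub : closedBall z ρ ⊆ ball 0 r := (closedBall_subset_ball (by linarith)).trans hz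
  exact Complex.norm_deriv_le_of_forall_mem_sphere_norm_le hρ
    (hf.mono ((closure_ball_subset_closedBall).trans hsub)).diffContOnCl
    fun w hw => hB w (hsub (sphere_subset_closedBall hw))

/-- Only the kernel needs a dominating function: Cauchy's estimate turns it into one for the
derivative on a smaller disc. -/
theorem hasDerivAt_integral_of_holomorphic (hK : ∀ a, DifferentiableOn ℂ (K · a) (ball 0 r))
    (hm : ∀ z ∈ ball (0 : ℂ) r, AEStronglyMeasurable (K z) μ)
    (hb : ∀ z ∈ ball (0 : ℂ) r, ∀ a, ‖K z a‖ ≤ b a) (hbi : Integrable b μ)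
    {z : ℂ} (hz : z ∈ ball (0 : ℂ) r) :
    Integrable (fun a => deriv (K · a) z) μ ∧
      HasDerivAt (fun z => ∫ a, K z a ∂μ) (∫ a, deriv (K · a) z ∂μ) z := by
  obtain ⟨ε, hε, hsub⟩ := Metric.isOpen_iff.1 isOpen_ball z hz
  have hε3 : 0 < ε / 3 := by positivity
  have hnear : ∀ w ∈ ball z (ε / 3), ball w (2 * (ε / 3)) ⊆ ball 0 r := fun w hw =>
    (ball_subset_ball' (by have := mem_ball.1 hw; linarith)).trans hsub
  refine hasDerivAt_integral_of_dominated_loc_of_deriv_le (F' := fun z a => deriv (K · a) z)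
    (bound := fun a => b a / (ε / 3))
    (ball_mem_nhds z hε3) ?_ (hbi.mono' (hm z hz) (.of_forall (hb z hz)))
    (aestronglyMeasurable_deriv_param hz hK hm) (.of_forall fun a w hw => ?_)
    (hbi.div_const _) (.of_forall fun a w hw => ?_)
  · filter_upwards [isOpen_ball.mem_nhds hz] with w hw using hm w hw
  · exact norm_deriv_le_div hε3 (hnear w hw) (hK a) fun z hz => hb z hz a
  · exact ((hK a).differentiableAt (isOpen_ball.mem_nhds
      (hnear w hw (mem_ball_self (by positivity))))).hasDerivAt

theorem differentiableOn_integral_of_holomorphic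
    (hK : ∀ a, DifferentiableOn ℂ (K · a) (ball 0 r))
    (hm : ∀ z ∈ ball (0 : ℂ) r, AEStronglyMeasurable (K z) μ)
    (hb : ∀ z ∈ ball (0 : ℂ) r, ∀ a, ‖K z a‖ ≤ b a) (hbi : Integrable b μ) :
    DifferentiableOn ℂ (fun z => ∫ a, K z a ∂μ) (ball 0 r) := fun _ hz =>
  (hasDerivAt_integral_of_holomorphic hK hm hb hbi hz).2.differentiableAt.differentiableWithinAt

theorem iteratedDeriv_one_integral_of_holomorphic (hr : 0 < r)
    (hK : ∀ a, DifferentiableOn ℂ (K · a) (ball 0 r))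
    (hm : ∀ z ∈ ball (0 : ℂ) r, AEStronglyMeasurable (K z) μ)
    (hb : ∀ z ∈ ball (0 : ℂ) r, ∀ a, ‖K z a‖ ≤ b a) (hbi : Integrable b μ) :
    Integrable (fun a => iteratedDeriv 1 (K · a) 0) μ ∧
    iteratedDeriv 1 (fun z => ∫ a, K z a ∂μ) 0 = ∫ a, iteratedDeriv 1 (K · a) 0 ∂μ := by
  simp only [iteratedDeriv_one]
  have := hasDerivAt_integral_of_holomorphic hK hm hb hbi (mem_ball_self hr)
  exact ⟨this.1, this.2.deriv⟩

theorem iteratedDeriv_two_integral_of_holomorphic (hr : 0 < r)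
    (hK : ∀ a, DifferentiableOn ℂ (K · a) (ball 0 r))
    (hm : ∀ z ∈ ball (0 : ℂ) r, AEStronglyMeasurable (K z) μ)
    (hb : ∀ z ∈ ball (0 : ℂ) r, ∀ a, ‖K z a‖ ≤ b a) (hbi : Integrable b μ) :
    Integrable (fun a => iteratedDeriv 2 (K · a) 0) μ ∧
    iteratedDeriv 2 (fun z => ∫ a, K z a ∂μ) 0 = ∫ a, iteratedDeriv 2 (K · a) 0 ∂μ := by
  have hsub : ball (0 : ℂ) (r / 3) ⊆ ball 0 r := ball_subset_ball (by linarith)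
  have hnear : ∀ w ∈ ball (0 : ℂ) (r / 3), ball w (2 * (r / 3)) ⊆ ball 0 r := fun w hw =>
    ball_subset_ball' (by have := mem_ball.1 hw; linarith)
  -- The first-order statement for the kernel `deriv K`, which is dominated by `b / (r/3)` on the
  -- disc of radius `r/3`.
  have key := iteratedDeriv_one_integral_of_holomorphic (K := fun z a => deriv (K · a) z)
    (μ := μ) (b := fun a => b a / (r / 3)) (r := r / 3) (by positivity)
    (fun a => ((hK a).deriv isOpen_ball).mono hsub)
    (fun z hz => aestronglyMeasurable_deriv_param (hsub hz) hK hm)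
    (fun z hz a => norm_deriv_le_div (by positivity) (hnear z hz) (hK a) fun z hz => hb z hz a)
    (hbi.div_const _)
  have h2 : ∀ f : ℂ → ℂ, iteratedDeriv 2 f 0 = iteratedDeriv 1 (deriv f) 0 := fun f => by
    rw [iteratedDeriv_succ']
  have h3 : deriv (fun z => ∫ a, K z a ∂μ) =ᶠ[nhds 0] fun z => ∫ a, deriv (K · a) z ∂μ := by
    filter_upwards [ball_mem_nhds (0 : ℂ) hr] with z hz using
      (hasDerivAt_integral_of_holomorphic hK hm hb hbi hz).2.deriv
  simp only [h2]
  refine ⟨key.1, ?_⟩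
  rw [← key.2, iteratedDeriv_one, iteratedDeriv_one, h3.deriv_eq]

end HolomorphicIntegral

/-! ### Bounds for the one-dimensional complexified Gaussian density. -/

section ComplexKernel

open Metric

/-- The holomorphic continuation of the Gaussian log-density in the centered variable `x`, with the
mean displaced by `ζ`, and variance `w`. -/
noncomputable def complexLogKernel (ζ w : ℂ) (x : ℝ) : ℂ :=
  -(1 / 2 * Complex.log (2 * Real.pi * w)) - (x - ζ) ^ 2 / (2 * w)

/-- The complex exponent differs from `x²/(2v)` by `N/(2wv)`, whose modulus is at most `η (4x² +
2v)/(2v)`: a slightly wider Gaussian and an additive `η`. -/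
theorem re_neg_sq_div_le {η v x : ℝ} {ζ w : ℂ} (hv : 0 < v) (hη : 0 ≤ η) (hη8 : η ≤ 1 / 8)
    (hw : ‖w - v‖ ≤ η * v) (hζ : ‖ζ‖ ^ 2 ≤ η ^ 2 * v) :
    (-((x - ζ) ^ 2 / (2 * w))).re ≤ -((1 - 4 * η) * x ^ 2 / (2 * v)) + η := by
  have hwn : v * (1 - η) ≤ ‖w‖ := by
    have h1 := norm_sub_norm_le (v : ℂ) ((v : ℂ) - w)
    rw [sub_sub_cancel, norm_sub_rev, Complex.norm_real, Real.norm_of_nonneg hv.le] at h1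
    linarith
  have hwpos : 0 < ‖w‖ := lt_of_lt_of_le (by nlinarith) hwn
  have hw0 : w ≠ 0 := norm_pos_iff.1 hwpos
  have hvc : (v : ℂ) ≠ 0 := by exact_mod_cast hv.ne'
  set N : ℂ := (x : ℂ) ^ 2 * (v - w) + v * (-2 * x * ζ + ζ ^ 2) with hN
  have hid : (x - ζ) ^ 2 / (2 * w) = ((x ^ 2 / (2 * v) : ℝ) : ℂ) + N / (2 * w * v) := by
    rw [hN]; push_cast; field_simp; ring
  -- AM-GM in a form that avoids `√v`: expand `(η|x| - ‖ζ‖)² ≥ 0` and divide by `η`, whence the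
  -- separate case `η = 0`.
  have hxz : 2 * (|x| * ‖ζ‖) ≤ η * (v + x ^ 2) := by
    rcases hη.eq_or_lt with h0 | h0
    · have : ‖ζ‖ = 0 := by
        have : ‖ζ‖ ^ 2 ≤ 0 := by simpa [← h0] using hζ
        exact pow_eq_zero_iff two_ne_zero |>.1 (le_antisymm this (sq_nonneg _))
      simp [this, ← h0]
    · have h1 := sq_nonneg (η * |x| - ‖ζ‖)
      have h2 : 2 * η * (|x| * ‖ζ‖) ≤ η * (η * (v + x ^ 2)) := by
        nlinarith [sq_abs x]
      nlinarith
  have hNn : ‖N‖ ≤ v * (η * (4 * x ^ 2 + 2 * v)) * (1 - η) := by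
    have h1 : ‖N‖ ≤ x ^ 2 * (η * v) + v * (2 * (|x| * ‖ζ‖) + ‖ζ‖ ^ 2) := by
      rw [hN]
      refine (norm_add_le _ _).trans (add_le_add ?_ ?_)
      · rw [norm_mul, norm_pow, Complex.norm_real, Real.norm_eq_abs, sq_abs, norm_sub_rev]
        gcongr
      · rw [norm_mul, Complex.norm_real, Real.norm_of_nonneg hv.le]
        gcongr
        refine (norm_add_le _ _).trans (add_le_add ?_ ?_)
        · simp [mul_assoc]
        · rw [norm_pow]
    refine h1.trans ?_
    have h2 : x ^ 2 * (η * v) + v * (2 * (|x| * ‖ζ‖) + ‖ζ‖ ^ 2)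
        ≤ v * (x ^ 2 * η + η * (v + x ^ 2) + η ^ 2 * v) := by nlinarith
    refine h2.trans ?_
    rw [mul_assoc]
    gcongr
    have h3 : 0 ≤ η * x ^ 2 := by positivity
    have h4 : 0 ≤ η * v := by positivity
    nlinarith
  have hq : ‖N / (2 * w * v)‖ ≤ η * (4 * x ^ 2 + 2 * v) / (2 * v) := by
    rw [norm_div, norm_mul, norm_mul, Complex.norm_real, Real.norm_of_nonneg hv.le, Complex.norm_two,
      div_le_div_iff₀ (by positivity) (by positivity)]
    calc ‖N‖ * (2 * v) ≤ (v * (η * (4 * x ^ 2 + 2 * v)) * (1 - η)) * (2 * v) := by gcongr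
      _ = η * (4 * x ^ 2 + 2 * v) * (2 * (v * (1 - η)) * v) := by ring
      _ ≤ _ := by gcongr
  have hre := Complex.abs_re_le_norm (N / (2 * w * v))
  rw [hid, Complex.neg_re, Complex.add_re, Complex.ofReal_re]
  have h5 := neg_abs_le (N / (2 * w * v)).re
  have h6 : -((1 - 4 * η) * x ^ 2 / (2 * v)) + η
      = -(x ^ 2 / (2 * v)) + η * (4 * x ^ 2 + 2 * v) / (2 * v) := by field_simp; ring
  linarith

theorem re_complexLogKernel_le {η v x : ℝ} {ζ w : ℂ} (hv : 0 < v) (hη : 0 ≤ η) (hη8 : η ≤ 1 / 8)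
    (hw : ‖w - v‖ ≤ η * v) (hζ : ‖ζ‖ ^ 2 ≤ η ^ 2 * v) :
    (complexLogKernel ζ w x).re ≤
      -(1 / 2 * Real.log (2 * Real.pi * v)) + 2 * η - (1 - 4 * η) * x ^ 2 / (2 * v) := by
  have h1 := re_neg_sq_div_le (x := x) hv hη hη8 hw hζ
  have hwn : v * (1 - η) ≤ ‖w‖ := by
    have h1 := norm_sub_norm_le (v : ℂ) ((v : ℂ) - w)
    rw [sub_sub_cancel, norm_sub_rev, Complex.norm_real, Real.norm_of_nonneg hv.le] at h1
    linarith
  have h2 : Real.log (2 * Real.pi * v) - 2 * η ≤ Real.log ‖(2 * Real.pi * w : ℂ)‖ := by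
    rw [← Real.log_exp (2 * η), ← Real.log_div (by positivity) (Real.exp_pos _).ne']
    apply Real.log_le_log (by positivity)
    rw [norm_mul, norm_mul, Complex.norm_two, Complex.norm_real, Real.norm_of_nonneg Real.pi_pos.le,
      div_le_iff₀ (Real.exp_pos _)]
    have h3 := Real.add_one_le_exp (2 * η)
    have h4 : v ≤ ‖w‖ * Real.exp (2 * η) := by
      calc v ≤ (v * (1 - η)) * (2 * η + 1) := by
            have : 0 ≤ v * (η * (1 - 2 * η)) := mul_nonneg hv.le (mul_nonneg hη (by linarith))
            nlinarith
        _ ≤ _ := by gcongr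
    calc 2 * Real.pi * v ≤ 2 * Real.pi * (‖w‖ * Real.exp (2 * η)) := by gcongr
      _ = _ := by ring
  have h5 : (complexLogKernel ζ w x).re
      = -(1 / 2 * Real.log ‖(2 * Real.pi * w : ℂ)‖) + (-((x - ζ) ^ 2 / (2 * w))).re := by
    rw [complexLogKernel, sub_eq_add_neg, Complex.add_re, ← Complex.log_re]
    simp
  rw [h5]
  linarith

/-- The integral equals `e^{2η} (1 - 4η)^{-1/2}`, and `(1 - 4η)⁻¹ ≤ e^{8η}` for `η ≤ 1/8`. -/
theorem integral_exp_kernel_bound {η v : ℝ} (m : ℝ) (hv : 0 < v) (hη : 0 ≤ η) (hη8 : η ≤ 1 / 8) :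
    Integrable (fun x : ℝ => Real.exp (-(1 / 2 * Real.log (2 * Real.pi * v)) + 2 * η
      - (1 - 4 * η) * (x - m) ^ 2 / (2 * v))) ∧
    ∫ x : ℝ, Real.exp (-(1 / 2 * Real.log (2 * Real.pi * v)) + 2 * η
      - (1 - 4 * η) * (x - m) ^ 2 / (2 * v)) ≤ Real.exp (6 * η) := by
  have hb : 0 < (1 - 4 * η) / (2 * v) := div_pos (by linarith) (by linarith)
  have he : ∀ x : ℝ, Real.exp (-(1 / 2 * Real.log (2 * Real.pi * v)) + 2 * η
      - (1 - 4 * η) * (x - m) ^ 2 / (2 * v)) =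
      Real.exp (-(1 / 2 * Real.log (2 * Real.pi * v)) + 2 * η) *
        Real.exp (-((1 - 4 * η) / (2 * v)) * (x - m) ^ 2) := fun x => by
    rw [← Real.exp_add]; congr 1; ring
  simp_rw [he]
  refine ⟨((integrable_exp_neg_mul_sq hb).comp_sub_right m).const_mul _, ?_⟩
  rw [integral_const_mul, integral_sub_right_eq_self
    (fun x => Real.exp (-((1 - 4 * η) / (2 * v)) * x ^ 2)), integral_gaussian]
  have h1 : Real.pi / ((1 - 4 * η) / (2 * v)) = 2 * Real.pi * v / (1 - 4 * η) := by field_simp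
  have hpos : 0 < 2 * Real.pi * v := by positivity
  have h14 : 0 < 1 - 4 * η := by linarith
  have hsq : √(2 * Real.pi * v / (1 - 4 * η)) ≤ Real.exp (1 / 2 * Real.log (2 * Real.pi * v) + 4 * η) := by
    rw [Real.sqrt_le_left (Real.exp_pos _).le, ← Real.exp_nat_mul, Nat.cast_two, mul_add, ← mul_assoc,
      show (2 : ℝ) * (1 / 2) = 1 by norm_num, one_mul, Real.exp_add, Real.exp_log hpos,
      div_le_iff₀ h14, mul_assoc _ (Real.exp _)]
    refine le_mul_of_one_le_right hpos.le ?_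
    have := Real.add_one_le_exp (2 * (4 * η))
    nlinarith
  rw [h1]
  calc _ ≤ Real.exp (-(1 / 2 * Real.log (2 * Real.pi * v)) + 2 * η) *
        Real.exp (1 / 2 * Real.log (2 * Real.pi * v) + 4 * η) := by gcongr
    _ = _ := by rw [← Real.exp_add]; congr 1; ring

end ComplexKernel

/-! ### Holomorphic continuation of Gaussian averages along lines. -/

section Slices

open Metric

variable {k d : ℕ}

/-- The holomorphic continuation to complex `z` of the density of `N(M, v)` along the line
`p + z • q`. -/
noncomputable def complexKernel (p q : Param k d) (z : ℂ) (a : Fin k → Fin d → ℝ) : ℂ :=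
  Complex.exp (∑ i, ∑ j, complexLogKernel (z * q.mean i j) (p.var + z * q.var)
    (a i j - p.mean i j))

/-- An integrable bound for the continued densities. -/
noncomputable def kernelBound (η : ℝ) (p : Param k d) (a : Fin k → Fin d → ℝ) : ℝ :=
  Real.exp (∑ i, ∑ j, (-(1 / 2 * Real.log (2 * Real.pi * p.var)) + 2 * η
    - (1 - 4 * η) * (a i j - p.mean i j) ^ 2 / (2 * p.var)))

variable {p q : Param k d} {η r : ℝ}

theorem integrable_kernelBound (hv : 0 < p.var) (hη : 0 ≤ η) (hη8 : η ≤ 1 / 8) :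
    Integrable (kernelBound η p) := by
  unfold kernelBound
  exact integrable_exp_sum_sum (f := fun i j x => -(1 / 2 * Real.log (2 * Real.pi * p.var)) + 2 * η
    - (1 - 4 * η) * (x - p.mean i j) ^ 2 / (2 * p.var))
    fun i j => (integral_exp_kernel_bound (p.mean i j) hv hη hη8).1

/-- Each of the `kd` entries costs a factor `e^{6η}`. Keeping the product bounded forces `η` to be
of order `1/(kd)`, which is where the dimension enters the radius of holomorphy. -/
theorem integral_kernelBound_le (hv : 0 < p.var) (hη : 0 ≤ η) (hη8 : η ≤ 1 / 8)
    (hN : η * (k * d) ≤ 1 / 8) : ∫ a, kernelBound η p a ≤ 3 := by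
  simp only [kernelBound]
  rw [integral_exp_sum_sum fun i j x => -(1 / 2 * Real.log (2 * Real.pi * p.var)) + 2 * η
    - (1 - 4 * η) * (x - p.mean i j) ^ 2 / (2 * p.var)]
  calc _ ≤ ∏ i : Fin k, ∏ j : Fin d, Real.exp (6 * η) := by
        refine Finset.prod_le_prod (fun i _ => Finset.prod_nonneg fun j _ =>
          integral_nonneg fun x => (Real.exp_pos _).le) fun i _ =>
          Finset.prod_le_prod (fun j _ => integral_nonneg fun x => (Real.exp_pos _).le)
          fun j _ => (integral_exp_kernel_bound (p.mean i j) hv hη hη8).2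
    _ = Real.exp (6 * (η * (k * d))) := by
        simp only [Finset.prod_const, Finset.card_univ, Fintype.card_fin, ← Real.exp_nat_mul]
        congr 1; ring
    _ ≤ Real.exp 1 := by gcongr; linarith
    _ ≤ 3 := Real.exp_one_lt_d9.le.trans (by norm_num)

/-- The disc of radius `r` around `p` in the direction `q` stays in the domain of holomorphy of
the Gaussian density. -/
structure IsSmallDirection (p q : Param k d) (η r : ℝ) : Prop where
  var_pos : 0 < p.var
  η_nonneg : 0 ≤ η
  η_le : η ≤ 1 / 8
  r_pos : 0 < r
  r_le : r ≤ η * p.var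
  r_sq_le : r ^ 2 ≤ η ^ 2 * p.var
  abs_mean_le : ∀ i j, |q.mean i j| ≤ 1
  abs_var_le : |q.var| ≤ 1

namespace IsSmallDirection

variable (h : IsSmallDirection p q η r)

include h

theorem norm_var_sub_le {z : ℂ} (hz : z ∈ ball (0 : ℂ) r) :
    ‖((p.var : ℂ) + z * q.var) - p.var‖ ≤ η * p.var := by
  rw [add_sub_cancel_left, norm_mul, Complex.norm_real]
  have hz' : ‖z‖ ≤ r := by simpa using (mem_ball.1 hz).le
  calc ‖z‖ * ‖q.var‖ ≤ r * 1 := by gcongr; exact h.r_pos.le; exact h.abs_var_le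
    _ ≤ _ := by rw [mul_one]; exact h.r_le

theorem re_var_pos {z : ℂ} (hz : z ∈ ball (0 : ℂ) r) : 0 < ((p.var : ℂ) + z * q.var).re := by
  have h1 := (Complex.abs_re_le_norm _).trans (h.norm_var_sub_le hz)
  rw [Complex.sub_re, Complex.ofReal_re, abs_le] at h1
  have := h.var_pos
  have := h.η_le
  nlinarith [h1.1]

theorem norm_complexKernel_le {z : ℂ} (hz : z ∈ ball (0 : ℂ) r) (a : Fin k → Fin d → ℝ) :
    ‖complexKernel p q z a‖ ≤ kernelBound η p a := by
  rw [complexKernel, kernelBound, Complex.norm_exp]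
  simp only [Complex.re_sum]
  gcongr with i _ j _
  have := re_complexLogKernel_le (x := a i j - p.mean i j) h.var_pos h.η_nonneg h.η_le
    (h.norm_var_sub_le hz) (ζ := z * q.mean i j) (by
      have hz' : ‖z‖ ≤ r := by simpa using (mem_ball.1 hz).le
      refine le_trans ?_ h.r_sq_le
      rw [norm_mul, Complex.norm_real]
      calc (‖z‖ * ‖q.mean i j‖) ^ 2 ≤ (r * 1) ^ 2 := by
            gcongr; exact h.r_pos.le; exact h.abs_mean_le i j
        _ = r ^ 2 := by rw [mul_one])
  simpa using this

theorem differentiableOn_complexKernel (a : Fin k → Fin d → ℝ) :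
    DifferentiableOn ℂ (complexKernel p q · a) (ball 0 r) := by
  refine DifferentiableOn.cexp (DifferentiableOn.fun_sum fun i _ =>
    DifferentiableOn.fun_sum fun j _ => ?_)
  have hw : DifferentiableOn ℂ (fun z : ℂ => (p.var : ℂ) + z * q.var) (ball 0 r) := by fun_prop
  unfold complexLogKernel
  refine DifferentiableOn.sub (DifferentiableOn.neg (DifferentiableOn.const_mul
    (DifferentiableOn.clog (hw.const_mul _) fun z hz => .inl ?_) _))
    (DifferentiableOn.div (by fun_prop) (hw.const_mul _) fun z hz => mul_ne_zero two_ne_zero ?_)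
  · have := h.re_var_pos hz
    rw [show (2 * (Real.pi : ℂ)) = ((2 * Real.pi : ℝ) : ℂ) by push_cast; rfl, Complex.re_ofReal_mul]
    positivity
  · intro h0
    have := h.re_var_pos hz
    rw [h0] at this
    simp at this

theorem complexKernel_ofReal {t : ℝ} (ht : |t| < r) (a : Fin k → Fin d → ℝ) :
    complexKernel p q t a
      = (gaussianMatrixDensity (p + t • q).mean (p + t • q).var a : ℂ) := by
  have hmem : (t : ℂ) ∈ ball (0 : ℂ) r := by simpa using ht
  have hpos : 0 < p.var + t * q.var := by simpa using h.re_var_pos hmem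
  have hv : (p + t • q).var = p.var + t * q.var := rfl
  have hM : ∀ i j, (p + t • q).mean i j = p.mean i j + t * q.mean i j := fun i j => rfl
  rw [complexKernel, gaussianMatrixDensity, Complex.ofReal_exp]
  congr 1
  push_cast
  refine Finset.sum_congr rfl fun i _ => Finset.sum_congr rfl fun j _ => ?_
  rw [complexLogKernel, hv, hM, Complex.ofReal_log (by positivity)]
  push_cast
  ring

end IsSmallDirection

theorem measurable_complexKernel (p q : Param k d) (z : ℂ) : Measurable (complexKernel p q z) := by
  unfold complexKernel complexLogKernel
  fun_prop

/-- The holomorphic continuation of the Gaussian average along a line. -/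
noncomputable def complexAverage (φ : (Fin k → Fin d → ℝ) → ℝ) (p q : Param k d) (z : ℂ) : ℂ :=
  ∫ a, complexKernel p q z a * φ a

variable {φ : (Fin k → Fin d → ℝ) → ℝ} {C : ℝ}

namespace IsSmallDirection

variable (h : IsSmallDirection p q η r)

include h

theorem norm_complexKernel_mul_le (hC : ∀ a, |φ a| ≤ C) :
    ∀ z ∈ ball (0 : ℂ) r, ∀ a, ‖complexKernel p q z a * φ a‖ ≤ kernelBound η p a * C := by
  intro z hz a
  rw [norm_mul, Complex.norm_real]
  exact mul_le_mul (h.norm_complexKernel_le hz a) (hC a) (norm_nonneg _) (Real.exp_pos _).le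

theorem differentiableOn_complexKernel_mul (a : Fin k → Fin d → ℝ) :
    DifferentiableOn ℂ (fun z => complexKernel p q z a * φ a) (ball 0 r) :=
  (h.differentiableOn_complexKernel a).mul_const _

omit h in
theorem measurable_complexKernel_mul (hφ : Measurable φ) (z : ℂ) :
    AEStronglyMeasurable fun a => complexKernel p q z a * φ a :=
  ((measurable_complexKernel p q z).mul
    (Complex.measurable_ofReal.comp hφ)).aestronglyMeasurable

theorem differentiableOn_complexAverage (hφ : Measurable φ) (hC : ∀ a, |φ a| ≤ C) :
    DifferentiableOn ℂ (complexAverage φ p q) (ball 0 r) :=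
  differentiableOn_integral_of_holomorphic h.differentiableOn_complexKernel_mul
    (fun z _ => measurable_complexKernel_mul hφ z) (h.norm_complexKernel_mul_le hC)
    ((integrable_kernelBound h.var_pos h.η_nonneg h.η_le).mul_const C)

theorem norm_complexAverage_le (hC : ∀ a, |φ a| ≤ C) (hN : η * (k * d) ≤ 1 / 8) {z : ℂ}
    (hz : z ∈ ball (0 : ℂ) r) : ‖complexAverage φ p q z‖ ≤ 3 * C := by
  have hC0 : 0 ≤ C := (abs_nonneg _).trans (hC 0)
  refine (norm_integral_le_of_norm_le
    ((integrable_kernelBound h.var_pos h.η_nonneg h.η_le).mul_const C)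
    (.of_forall (h.norm_complexKernel_mul_le hC z hz))).trans ?_
  rw [integral_mul_const]
  exact mul_le_mul_of_nonneg_right (integral_kernelBound_le h.var_pos h.η_nonneg h.η_le hN) hC0

theorem var_add_smul_pos {t : ℝ} (ht : |t| < r) : 0 < (p + t • q).var := by
  have hmem : (t : ℂ) ∈ ball (0 : ℂ) r := by simpa using ht
  have hpos : 0 < p.var + t * q.var := by simpa using h.re_var_pos hmem
  exact hpos

theorem gaussianAverage_eq_re {t : ℝ} (ht : |t| < r) :
    gaussianAverage φ (p + t • q) = (complexAverage φ p q t).re := by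
  rw [gaussianAverage, integral_gaussianMatrix _ (h.var_add_smul_pos ht), complexAverage]
  simp_rw [h.complexKernel_ofReal ht, ← Complex.ofReal_mul]
  rw [integral_complex_ofReal, Complex.ofReal_re]

theorem sliceDeriv_gaussianAverage (hφ : Measurable φ) (hC : ∀ a, |φ a| ≤ C) {m : ℕ}
    (hm : m ≤ 3) : sliceDeriv (gaussianAverage φ) p q m 0
      = (iteratedDeriv m (complexAverage φ p q) 0).re := by
  have := eq_re_iteratedDeriv_of_slice (h.differentiableOn_complexAverage hφ hC)
    (e := sliceDeriv (gaussianAverage φ) p q) (N := 3) (fun m hm t ht => hasDerivAt_sliceDeriv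
      isOpen_var_pos (contDiffOn_gaussianAverage hφ hC 3) (h.var_add_smul_pos ht) hm)
    (fun t ht => h.gaussianAverage_eq_re ht) m hm 0 (by simpa using h.r_pos)
  simpa using this

end IsSmallDirection

theorem Param.abs_mean_le (p : Param k d) (i : Fin k) (j : Fin d) : |p.mean i j| ≤ ‖p‖ := by
  simpa [Param.mean] using PiLp.norm_apply_le p (Sum.inl (i, j))

theorem isSmallDirection_of_norm_le {v₀ : ℝ} (hv₀ : 0 < v₀) (hv₀1 : v₀ ≤ 1) (hp : v₀ ≤ p.var)
    (hη : 0 < η) (hη8 : η ≤ 1 / 8) (hq : ‖q‖ ≤ 1) : IsSmallDirection p q η (η * v₀) where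
  var_pos := hv₀.trans_le hp
  η_nonneg := hη.le
  η_le := hη8
  r_pos := by positivity
  r_le := by gcongr
  r_sq_le := by
    rw [mul_pow]
    gcongr
    nlinarith
  abs_mean_le i j := (q.abs_mean_le i j).trans hq
  abs_var_le := q.abs_var_le.trans hq

theorem hasHolomorphicSlices_gaussianAverage (hφ : Measurable φ) (hC : ∀ a, |φ a| ≤ C)
    {v₀ : ℝ} (hv₀ : 0 < v₀) (hv₀1 : v₀ ≤ 1) (hη : 0 < η) (hη8 : η ≤ 1 / 8)
    (hN : η * (k * d) ≤ 1 / 8) :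
    HasHolomorphicSlices (gaussianAverage φ) (3 * C) (η * v₀) {p : Param k d | v₀ ≤ p.var} := by
  intro p hp q hq
  have h := isSmallDirection_of_norm_le hv₀ hv₀1 hp hη hη8 hq.le
  exact ⟨complexAverage φ p q, h.differentiableOn_complexAverage hφ hC,
    fun z hz => h.norm_complexAverage_le hC hN hz, fun t ht => h.gaussianAverage_eq_re ht⟩

end Slices

/-! ### The heat equation for Gaussian averages. -/

section HeatEquation

variable {k d : ℕ}

/-- The unit vector in the direction of the variance. -/
noncomputable def varDir : Param k d := EuclideanSpace.single (Sum.inr ()) 1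

/-- The unit vector in the direction of a matrix entry. -/
noncomputable def entryDir (i : Fin k) (j : Fin d) : Param k d :=
  EuclideanSpace.single (Sum.inl (i, j)) 1

theorem norm_varDir : ‖(varDir : Param k d)‖ = 1 := by simp [varDir]

theorem norm_entryDir (i : Fin k) (j : Fin d) : ‖entryDir i j‖ = 1 := by simp [entryDir]

theorem iteratedDeriv_two_cexp_quadratic (A B D c : ℂ) :
    iteratedDeriv 2 (fun z => Complex.exp (A + B * z + D * z ^ 2) * c) 0
      = (2 * D + B ^ 2) * (Complex.exp A * c) := by
  have h0 : ∀ z, HasDerivAt (fun z => A + B * z + D * z ^ 2) (B + D * (2 * z)) z := fun z => by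
    have := (((hasDerivAt_id z).const_mul B).const_add A).add
      (((hasDerivAt_id z).pow 2).const_mul D)
    simpa using! this
  have h1 : deriv (fun z => Complex.exp (A + B * z + D * z ^ 2) * c)
      = fun z => Complex.exp (A + B * z + D * z ^ 2) * (B + D * (2 * z)) * c :=
    funext fun z => ((h0 z).cexp.mul_const c).deriv
  have h2 : HasDerivAt (fun z => B + D * (2 * z)) (D * 2) 0 := by
    simpa using ((((hasDerivAt_id (0 : ℂ)).const_mul 2).const_mul D).const_add B)
  rw [iteratedDeriv_succ, iteratedDeriv_one, h1, (((h0 0).cexp.fun_mul h2).mul_const c).deriv]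
  simp
  ring

/-- At `z = 0` the kernel does not depend on the direction; the value is written with `varDir` to
match `iteratedDeriv_one_complexKernel_varDir`. Together the two say that the density itself solves
the heat equation. -/
theorem iteratedDeriv_two_complexKernel_entryDir {p : Param k d} (hv : 0 < p.var) (i : Fin k)
    (j : Fin d) (a : Fin k → Fin d → ℝ) (c : ℂ) :
    iteratedDeriv 2 (fun z => complexKernel p (entryDir i j) z a * c) 0
      = (-(p.var : ℂ)⁻¹ + ((a i j - p.mean i j) / p.var) ^ 2) *
        (complexKernel p varDir 0 a * c) := by
  have hv' : (p.var : ℂ) ≠ 0 := by exact_mod_cast hv.ne'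
  have hz : ∀ z, complexKernel p (entryDir i j) z a * c = Complex.exp
      ((∑ i, ∑ j, complexLogKernel 0 p.var (a i j - p.mean i j))
        + ((a i j - p.mean i j) / p.var) * z + -(1 / (2 * p.var)) * z ^ 2) * c := by
    intro z
    rw [complexKernel]
    congr 2
    have h1 : ∀ i' j', complexLogKernel (z * (entryDir i j).mean i' j')
        (p.var + z * (entryDir i j : Param k d).var) (a i' j' - p.mean i' j')
        = complexLogKernel 0 p.var (a i' j' - p.mean i' j') + if i' = i then (if j' = j then
          ((a i' j' - p.mean i' j') / p.var) * z + -(1 / (2 * p.var)) * z ^ 2 else 0) else 0 := by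
      intro i' j'
      by_cases hi : i' = i
      · by_cases hj : j' = j
        · subst hi hj
          simp [complexLogKernel, entryDir, Param.mean, Param.var]
          field_simp
          ring
        · simp [complexLogKernel, entryDir, Param.mean, Param.var, hj]
      · simp [complexLogKernel, entryDir, Param.mean, Param.var, hi]
    simp_rw [h1, Finset.sum_add_distrib]
    simp [add_assoc, Finset.sum_ite_irrel]
  simp_rw [hz]
  rw [iteratedDeriv_two_cexp_quadratic]
  congr 1
  · field_simp
  · simp [complexKernel]

theorem iteratedDeriv_one_complexKernel_varDir {p : Param k d} (hv : 0 < p.var)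
    (a : Fin k → Fin d → ℝ) (c : ℂ) :
    iteratedDeriv 1 (fun z => complexKernel p varDir z a * c) 0
      = (1 / 2) * ∑ i, ∑ j, (-(p.var : ℂ)⁻¹ + ((a i j - p.mean i j) / p.var) ^ 2) *
        (complexKernel p varDir 0 a * c) := by
  have hv' : (p.var : ℂ) ≠ 0 := by exact_mod_cast hv.ne'
  have hd : ∀ i j, HasDerivAt (fun z : ℂ => complexLogKernel (z * (varDir : Param k d).mean i j)
      (p.var + z * (varDir : Param k d).var) (a i j - p.mean i j))
      ((1 / 2) * (-(p.var : ℂ)⁻¹ + ((a i j - p.mean i j) / p.var) ^ 2)) 0 := by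
    intro i j
    have hw : HasDerivAt (fun z : ℂ => (p.var : ℂ) + z) 1 0 := (hasDerivAt_id 0).const_add _
    have h1 : HasDerivAt (fun z : ℂ => Complex.log (2 * Real.pi * ((p.var : ℂ) + z)))
        ((2 * Real.pi * 1) / (2 * Real.pi * ((p.var : ℂ) + 0))) 0 := by
      refine (hw.const_mul _).clog (.inl ?_)
      rw [add_zero, show (2 * (Real.pi : ℂ)) * p.var = ((2 * Real.pi * p.var : ℝ) : ℂ) by
        push_cast; rfl, Complex.ofReal_re]
      positivity
    have h2 := ((h1.const_mul (1 / 2)).neg).sub ((hasDerivAt_const (0 : ℂ)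
      (((a i j - p.mean i j : ℝ) : ℂ) ^ 2)).div (hw.const_mul 2) (by simpa using hv'))
    have hπ : (Real.pi : ℂ) ≠ 0 := by exact_mod_cast Real.pi_ne_zero
    have hf : (fun z : ℂ => complexLogKernel (z * (varDir : Param k d).mean i j)
        (p.var + z * (varDir : Param k d).var) (a i j - p.mean i j)) = fun z : ℂ =>
        -(1 / 2 * Complex.log (2 * Real.pi * ((p.var : ℂ) + z)))
          - ((a i j - p.mean i j : ℝ) : ℂ) ^ 2 / (2 * (p.var + z)) := by
      funext z
      simp [complexLogKernel, varDir, Param.mean, Param.var]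
    rw [hf]
    refine HasDerivAt.congr_deriv h2 ?_
    push_cast
    rw [add_zero]
    field_simp
    ring
  have h3 : HasDerivAt (fun z : ℂ => complexKernel p varDir z a * c) _ 0 :=
    ((HasDerivAt.fun_sum fun i _ => HasDerivAt.fun_sum fun j _ => hd i j).cexp).mul_const c
  rw [iteratedDeriv_one, h3.deriv, complexKernel]
  simp only [← Finset.mul_sum, ← Finset.sum_mul]
  ring

theorem heat_equation {φ : (Fin k → Fin d → ℝ) → ℝ} {C : ℝ} (hφ : Measurable φ)
    (hC : ∀ a, |φ a| ≤ C) {p : Param k d} (hv : 0 < p.var) :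
    inner ℝ (gradient (gaussianAverage φ) p) varDir
      = 1 / 2 * ∑ i, ∑ j,
        inner ℝ (hessian (gaussianAverage φ) p (entryDir i j)) (entryDir i j) := by
  -- Only differentiation under the integral is at stake here, so any positive radius will do and
  -- `η` need not shrink with `kd`.
  have hsm : ∀ q : Param k d, ‖q‖ = 1 → IsSmallDirection p q (1 / 8) (1 / 8 * min p.var 1) :=
    fun q hq => isSmallDirection_of_norm_le (lt_min hv one_pos) (min_le_right _ _)
      (min_le_left _ _) (by norm_num) le_rfl hq.le
  have hd := fun q hq m hm => (hsm q hq).sliceDeriv_gaussianAverage hφ hC (m := m) hm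
  have h1 := hd varDir norm_varDir 1 (by norm_num)
  have h2 := fun i j => hd (entryDir i j) (norm_entryDir i j) 2 (by norm_num)
  simp only [sliceDeriv, zero_smul, add_zero] at h1 h2
  have hb := (integrable_kernelBound hv (η := 1 / 8) (by norm_num) le_rfl).mul_const C
  have k1 := iteratedDeriv_one_integral_of_holomorphic (hsm _ norm_varDir).r_pos
    (hsm varDir norm_varDir).differentiableOn_complexKernel_mul
    (fun z _ => IsSmallDirection.measurable_complexKernel_mul hφ z)
    ((hsm _ norm_varDir).norm_complexKernel_mul_le hC) hb
  have k2 := fun i j => iteratedDeriv_two_integral_of_holomorphic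
    (hsm _ (norm_entryDir i j)).r_pos
    (hsm _ (norm_entryDir i j)).differentiableOn_complexKernel_mul
    (fun z _ => IsSmallDirection.measurable_complexKernel_mul hφ z)
    ((hsm _ (norm_entryDir i j)).norm_complexKernel_mul_le hC) hb
  have e1 : iteratedDeriv 1 (complexAverage φ p varDir) 0
      = 1 / 2 * ∑ i, ∑ j, iteratedDeriv 2 (complexAverage φ p (entryDir i j)) 0 := by
    unfold complexAverage
    rw [k1.2]
    simp_rw [fun i j => (k2 i j).2]
    rw [integral_congr_ae (.of_forall fun a => iteratedDeriv_one_complexKernel_varDir hv a (φ a)),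
      integral_const_mul]
    simp_rw [← iteratedDeriv_two_complexKernel_entryDir hv]
    rw [integral_finsetSum _ fun i _ => integrable_finsetSum _ fun j _ => (k2 i j).1]
    congr 1
    exact Finset.sum_congr rfl fun i _ => integral_finsetSum _ fun j _ => (k2 i j).1
  rw [h1, e1]
  simp_rw [h2]
  rw [show (1 / 2 : ℂ) = ((1 / 2 : ℝ) : ℂ) by push_cast; rfl, Complex.re_ofReal_mul]
  simp only [Complex.re_sum]

end HeatEquation

/-! ### The law of the image of a unit vector. -/

section LinearImage

variable {k d : ℕ}

/-- Compare characteristic functions: independence factors the left one, and `∑ y² = 1` preserves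
the variance. -/
theorem map_sum_mul_pi_gaussianReal {ι : Type*} [Fintype ι] (m y : ι → ℝ) (v : NNReal)
    (hy : ∑ j, y j ^ 2 = 1) :
    (Measure.pi fun j => gaussianReal (m j) v).map (fun x => ∑ j, x j * y j)
      = gaussianReal (∑ j, m j * y j) v := by
  have hmeas : Measurable fun x : ι → ℝ => ∑ j, x j * y j := by fun_prop
  have : IsProbabilityMeasure ((Measure.pi fun j => gaussianReal (m j) v).map
    (fun x => ∑ j, x j * y j)) := Measure.isProbabilityMeasure_map hmeas.aemeasurable
  refine Measure.ext_of_charFun ?_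
  funext t
  rw [charFun_apply_real, integral_map hmeas.aemeasurable (by fun_prop), charFun_gaussianReal]
  have h1 : ∀ x : ι → ℝ, Complex.exp (t * ((∑ j, x j * y j : ℝ) : ℂ) * Complex.I)
      = ∏ j, Complex.exp (((t * y j : ℝ) : ℂ) * x j * Complex.I) := fun x => by
    rw [← Complex.exp_sum]
    congr 1
    push_cast
    rw [Finset.mul_sum, Finset.sum_mul]
    exact Finset.sum_congr rfl fun j _ => by ring
  simp_rw [h1]
  rw [integral_fintype_prod_eq_prod
    (fun j (x : ℝ) => Complex.exp (((t * y j : ℝ) : ℂ) * x * Complex.I))]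
  simp_rw [← charFun_apply_real, charFun_gaussianReal, ← Complex.exp_sum]
  congr 1
  rw [Finset.sum_sub_distrib]
  congr 1
  · push_cast
    rw [Finset.mul_sum, Finset.sum_mul]
    exact Finset.sum_congr rfl fun j _ => by ring
  · have h2 : (∑ j, (y j : ℂ) ^ 2) = 1 := by exact_mod_cast hy
    push_cast
    calc _ = ∑ j, (v * t ^ 2 / 2 : ℂ) * (y j : ℂ) ^ 2 :=
          Finset.sum_congr rfl fun j _ => by ring
      _ = _ := by rw [← Finset.mul_sum, h2, mul_one]

theorem isProbabilityMeasure_row (M : Matrix (Fin k) (Fin d) ℝ) (v : NNReal) (i : Fin k) :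
    IsProbabilityMeasure (Measure.pi fun j => gaussianReal (M i j) v) := inferInstance

theorem normSqImage_eq (A : Matrix (Fin k) (Fin d) ℝ) (x : EuclideanSpace ℝ (Fin d)) :
    normSqImage A x = 1 / (k : ℝ) * ∑ i, (∑ j, A i j * x j) ^ 2 := by
  simp [normSqImage, EuclideanSpace.norm_sq_eq, Matrix.mulVec, dotProduct]

theorem sum_sq_eq_one {x : EuclideanSpace ℝ (Fin d)} (hx : ‖x‖ = 1) : ∑ j, x j ^ 2 = 1 := by
  have := EuclideanSpace.norm_sq_eq x
  rw [hx] at this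
  simpa using this.symm

theorem integral_prod_row (M : Matrix (Fin k) (Fin d) ℝ) (v : ℝ)
    {x : EuclideanSpace ℝ (Fin d)} (hx : ‖x‖ = 1) {h : ℝ → ℝ} (hh : Measurable h) :
    ∫ a, ∏ i, h (∑ j, a i j * x j) ∂gaussianMatrix M v
      = ∏ i, ∫ y, h y ∂gaussianReal (∑ j, M i j * x j) v.toNNReal := by
  have := isProbabilityMeasure_row M v.toNNReal
  rw [gaussianMatrix, integral_fintype_prod_eq_prod
    (fun i (y : Fin d → ℝ) => h (∑ j, y j * x j))]
  refine Finset.prod_congr rfl fun i _ => ?_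
  rw [← map_sum_mul_pi_gaussianReal (M i) x.ofLp _ (sum_sq_eq_one hx), integral_map
    (Measurable.aemeasurable (by fun_prop)) hh.aestronglyMeasurable]

theorem map_row (M : Matrix (Fin k) (Fin d) ℝ) (v : ℝ)
    {x : EuclideanSpace ℝ (Fin d)} (hx : ‖x‖ = 1) (i : Fin k) :
    (gaussianMatrix M v).map (fun a => ∑ j, a i j * x j)
      = gaussianReal (∑ j, M i j * x j) v.toNNReal := by
  have := isProbabilityMeasure_row M v.toNNReal
  have h1 := (measurePreserving_eval
    (fun i => Measure.pi fun j => gaussianReal (M i j) v.toNNReal) i).map_eq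
  rw [← map_sum_mul_pi_gaussianReal (M i) x.ofLp _ (sum_sq_eq_one hx), ← h1, gaussianMatrix,
    Measure.map_map (by fun_prop) (by fun_prop)]
  rfl

theorem integral_sq_sub_mean_row (M : Matrix (Fin k) (Fin d) ℝ) {v : ℝ} (hv : 0 ≤ v)
    {x : EuclideanSpace ℝ (Fin d)} (hx : ‖x‖ = 1) (i : Fin k) :
    Integrable (fun a => (∑ j, a i j * x j - ∑ j, M i j * x j) ^ 2) (gaussianMatrix M v) ∧
    ∫ a, (∑ j, a i j * x j - ∑ j, M i j * x j) ^ 2 ∂gaussianMatrix M v = v := by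
  set m := ∑ j, M i j * x j with hm
  have hmeas : Measurable fun a : Fin k → Fin d → ℝ => ∑ j, a i j * x j := by fun_prop
  have hsq : Measurable fun y : ℝ => (y - m) ^ 2 := by fun_prop
  have hint : Integrable (fun y : ℝ => (y - m) ^ 2) (gaussianReal m v.toNNReal) :=
    ((memLp_id_gaussianReal 2).sub (memLp_const m)).integrable_sq
  rw [← map_row M v hx i] at hint
  refine ⟨hint.comp_measurable hmeas, ?_⟩
  rw [← integral_map (f := fun y : ℝ => (y - m) ^ 2) hmeas.aemeasurable hsq.aestronglyMeasurable,
    map_row M v hx i]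
  have h1 := variance_fun_id_gaussianReal (μ := m) (v := v.toNNReal)
  rw [variance_eq_integral measurable_id'.aemeasurable, integral_id_gaussianReal,
    Real.coe_toNNReal _ hv] at h1
  exact h1

end LinearImage

/-! ### Chi-square tails by the Chernoff method. -/

section ChiSquare

variable {k d : ℕ}

/-- Equivalent to `-log (1 - u) ≤ u + u²`. With `u = 2s` it bounds the moment generating function
`(1 - 2s)^{-1/2}` of a squared standard normal. -/
theorem one_le_one_sub_mul_exp {u : ℝ} (h2 : u ≤ 1 / 2) :
    1 ≤ (1 - u) * Real.exp (u + u ^ 2) := by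
  rcases le_total 0 u with h | h
  · have h3 := Real.quadratic_le_exp_of_nonneg (x := u + u ^ 2) (by positivity)
    refine le_trans ?_ (mul_le_mul_of_nonneg_left h3 (by linarith))
    have h4 : (1 - u) * (1 + (u + u ^ 2) + (u + u ^ 2) ^ 2 / 2)
        = 1 + u ^ 2 * ((1 - u) * (1 + u) ^ 2 / 2 - u) := by ring
    rw [h4]
    have : 0 ≤ (1 - u) * (1 + u) ^ 2 / 2 - u := by nlinarith [sq_nonneg u]
    have := mul_nonneg (sq_nonneg u) this
    linarith
  · have h3 := Real.add_one_le_exp (u + u ^ 2)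
    refine le_trans ?_ (mul_le_mul_of_nonneg_left h3 (by linarith))
    nlinarith [mul_nonneg (sq_nonneg u) (neg_nonneg.2 h)]

theorem integral_exp_mul_sq_gaussianReal_le {s : ℝ} (hs : s ≤ 1 / 4) :
    ∫ y, Real.exp (s * y ^ 2) ∂gaussianReal 0 1 ≤ Real.exp (s + 2 * s ^ 2) := by
  rw [integral_gaussianReal_eq_integral_smul one_ne_zero]
  have he : ∀ y : ℝ, gaussianPDFReal 0 1 y • Real.exp (s * y ^ 2)
      = (√(2 * Real.pi))⁻¹ * Real.exp (-(1 / 2 - s) * y ^ 2) := fun y => by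
    rw [gaussianPDFReal, smul_eq_mul, mul_assoc, ← Real.exp_add, NNReal.coe_one, mul_one]
    congr 2
    ring
  simp_rw [he]
  have hpos : 0 < 1 - 2 * s := by linarith
  rw [integral_const_mul, integral_gaussian, ← Real.sqrt_inv, ← Real.sqrt_mul (by positivity),
    show (2 * Real.pi)⁻¹ * (Real.pi / (1 / 2 - s)) = 1 / (1 - 2 * s) by
      have := Real.pi_ne_zero
      rw [show 1 / 2 - s = (1 - 2 * s) / 2 by ring]
      field_simp, Real.sqrt_le_left (Real.exp_pos _).le, div_le_iff₀ hpos, ← Real.exp_nat_mul]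
  have := one_le_one_sub_mul_exp (u := 2 * s) (by linarith)
  refine this.trans_eq ?_
  rw [mul_comm]
  congr 2
  push_cast
  ring

theorem integral_exp_mul_sum_sq_le {s : ℝ} (hs : s ≤ 1 / 4)
    {x : EuclideanSpace ℝ (Fin d)} (hx : ‖x‖ = 1) :
    ∫ a, Real.exp (s * ∑ i, (∑ j, a i j * x j) ^ 2) ∂gaussianMatrix (0 : Matrix (Fin k) (Fin d) ℝ) 1
      ≤ Real.exp (k * (s + 2 * s ^ 2)) := by
  simp_rw [Finset.mul_sum, Real.exp_sum]
  rw [integral_prod_row 0 1 hx (h := fun y => Real.exp (s * y ^ 2)) (by fun_prop)]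
  simp only [Matrix.zero_apply, zero_mul, Finset.sum_const_zero, Real.toNNReal_one,
    Finset.prod_const, Finset.card_univ, Fintype.card_fin]
  rw [Real.exp_nat_mul]
  exact pow_le_pow_left₀ (integral_nonneg fun _ => (Real.exp_pos _).le)
    (integral_exp_mul_sq_gaussianReal_le hs) k

theorem integrable_exp_mul_sum_sq {s : ℝ} (h2 : s ≤ 1 / 4)
    {x : EuclideanSpace ℝ (Fin d)} (hx : ‖x‖ = 1) :
    Integrable (fun a : Fin k → Fin d → ℝ => Real.exp (s * ∑ i, (∑ j, a i j * x j) ^ 2))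
      (gaussianMatrix (0 : Matrix (Fin k) (Fin d) ℝ) 1) := by
  simp_rw [Finset.mul_sum, Real.exp_sum]
  have h1 : Integrable (fun y : ℝ => Real.exp (s * y ^ 2)) (gaussianReal 0 1) := by
    rw [gaussianReal_of_var_ne_zero _ one_ne_zero, integrable_withDensity_iff_integrable_smul₀'
      (measurable_gaussianPDF _ _).aemeasurable (.of_forall fun _ => gaussianPDF_lt_top)]
    simp_rw [toReal_gaussianPDF]
    have he : ∀ y : ℝ, gaussianPDFReal 0 1 y • Real.exp (s * y ^ 2)
        = (√(2 * Real.pi))⁻¹ * Real.exp (-(1 / 2 - s) * y ^ 2) := fun y => by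
      rw [gaussianPDFReal, smul_eq_mul, mul_assoc, ← Real.exp_add, NNReal.coe_one, mul_one]
      congr 2
      ring
    simp_rw [he]
    exact (integrable_exp_neg_mul_sq (by linarith)).const_mul _
  have := isProbabilityMeasure_row (0 : Matrix (Fin k) (Fin d) ℝ) (Real.toNNReal 1)
  rw [gaussianMatrix]
  refine Integrable.fintype_prod (f := fun i (y : Fin d → ℝ) => Real.exp (s * (∑ j, y j * x j) ^ 2))
    fun i => ?_
  have h3 := map_sum_mul_pi_gaussianReal (fun _ => 0) x.ofLp 1 (sum_sq_eq_one hx)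
  simp only [zero_mul, Finset.sum_const_zero] at h3
  rw [← h3] at h1
  have h4 := h1.comp_measurable (f := fun y : Fin d → ℝ => ∑ j, y j * x j) (by fun_prop)
  simp only [Matrix.zero_apply, Real.toNNReal_one]
  exact h4

theorem measurable_normSqImage (x : EuclideanSpace ℝ (Fin d)) :
    Measurable fun a : Fin k → Fin d → ℝ => normSqImage (Matrix.of a) x := by
  simp_rw [normSqImage_eq]
  simp only [Matrix.of_apply]
  fun_prop

theorem real_le_exp_of_forall_le {Ω : Type*} [MeasurableSpace Ω] {μ : Measure Ω}
    [IsFiniteMeasure μ] {X : Ω → ℝ} {S : Set Ω} {c B : ℝ}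
    (hS : ∀ a ∈ S, c ≤ X a) (hX : Integrable (fun a => Real.exp (X a)) μ)
    (hB : ∫ a, Real.exp (X a) ∂μ ≤ Real.exp B) : μ.real S ≤ Real.exp (B - c) := by
  have h1 := mul_meas_ge_le_integral_of_nonneg (.of_forall fun a => (Real.exp_pos (X a)).le) hX
    (Real.exp c)
  have h2 : μ.real S ≤ μ.real {a | Real.exp c ≤ Real.exp (X a)} :=
    measureReal_mono fun a ha => Real.exp_le_exp.2 (hS a ha)
  rw [sub_eq_add_neg, Real.exp_add, Real.exp_neg, ← div_eq_mul_inv,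
    le_div_iff₀ (Real.exp_pos c), mul_comm]
  calc Real.exp c * μ.real S ≤ _ := mul_le_mul_of_nonneg_left h2 (Real.exp_pos c).le
    _ ≤ _ := h1.trans hB

/-- Chernoff with exponent `s = ±ε/4`: in both tails the linear terms cancel and `k (ε²/8 - ε²/4)`
remains. The moment bound needs `s ≤ 1/4`, hence `ε ≤ 1`. -/
theorem real_normSqImage_notMem_Ioo_le (hk : 1 ≤ k) {ε : ℝ} (hε : 0 ≤ ε) (hε1 : ε ≤ 1)
    {x : EuclideanSpace ℝ (Fin d)} (hx : ‖x‖ = 1) :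
    (gaussianMatrix (0 : Matrix (Fin k) (Fin d) ℝ) 1).real
      {a | normSqImage (Matrix.of a) x ∉ Set.Ioo (1 - ε) (1 + ε)}
      ≤ 2 * Real.exp (-(k * ε ^ 2 / 8)) := by
  have hk0 : (0 : ℝ) < k := by exact_mod_cast hk
  set μ := gaussianMatrix (0 : Matrix (Fin k) (Fin d) ℝ) 1
  have hsub : {a : Fin k → Fin d → ℝ | normSqImage (Matrix.of a) x ∉ Set.Ioo (1 - ε) (1 + ε)} ⊆
      {a | k * (1 + ε) ≤ ∑ i, (∑ j, a i j * x j) ^ 2} ∪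
        {a | ∑ i, (∑ j, a i j * x j) ^ 2 ≤ k * (1 - ε)} := by
    intro a ha
    have h1 : normSqImage (Matrix.of a) x ∉ Set.Ioo (1 - ε) (1 + ε) := ha
    rw [normSqImage_eq, Set.mem_Ioo, not_and_or, not_lt, not_lt, one_div_mul_eq_div,
      div_le_iff₀ hk0, le_div_iff₀ hk0] at h1
    simp only [Matrix.of_apply] at h1
    rcases h1 with h1 | h1
    · exact .inr (by rw [mul_comm] at h1; exact h1)
    · exact .inl (by rw [mul_comm] at h1; exact h1)
  have hup : μ.real {a | k * (1 + ε) ≤ ∑ i, (∑ j, a i j * x j) ^ 2}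
      ≤ Real.exp (-(k * ε ^ 2 / 8)) := by
    refine (real_le_exp_of_forall_le (c := ε / 4 * (k * (1 + ε)))
      (fun a ha => mul_le_mul_of_nonneg_left ha (by positivity))
      (integrable_exp_mul_sum_sq (s := ε / 4) (by linarith) hx)
      (integral_exp_mul_sum_sq_le (by linarith) hx)).trans_eq ?_
    congr 1; ring
  have hlow : μ.real {a | ∑ i, (∑ j, a i j * x j) ^ 2 ≤ k * (1 - ε)}
      ≤ Real.exp (-(k * ε ^ 2 / 8)) := by
    refine (real_le_exp_of_forall_le (c := -(ε / 4) * (k * (1 - ε)))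
      (fun a ha => mul_le_mul_of_nonpos_left ha (by linarith))
      (integrable_exp_mul_sum_sq (s := -(ε / 4)) (by linarith) hx)
      (integral_exp_mul_sum_sq_le (by linarith) hx)).trans_eq ?_
    congr 1; ring
  calc _ ≤ _ := measureReal_mono hsub
    _ ≤ _ := measureReal_union_le _ _
    _ ≤ _ := by linarith

end ChiSquare

/-! ### Scaling of Gaussian matrices. -/

section Scaling

variable {k d : ℕ}

theorem gaussianMatrix_map_smul (M : Matrix (Fin k) (Fin d) ℝ) (v c : ℝ) :
    (gaussianMatrix M v).map (fun a i j => c * a i j) = gaussianMatrix (c • M) (c ^ 2 * v) := by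
  have hrow : ∀ i, (Measure.pi fun j => gaussianReal (M i j) v.toNNReal).map (fun y j => c * y j)
      = Measure.pi fun j => gaussianReal ((c • M) i j) (c ^ 2 * v).toNNReal := fun i => by
    have hs : ∀ j, SigmaFinite ((gaussianReal (M i j) v.toNNReal).map (c * ·)) := fun j => by
      rw [gaussianReal_map_const_mul]; infer_instance
    rw [Measure.pi_map_pi (fun j => Measurable.aemeasurable (by fun_prop))]
    congr 1
    funext j
    rw [gaussianReal_map_const_mul, Real.toNNReal_mul (sq_nonneg c)]
    congr 2
    exact (Real.toNNReal_of_nonneg (sq_nonneg c)).symm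
  have hs : ∀ i, SigmaFinite ((Measure.pi fun j => gaussianReal (M i j) v.toNNReal).map
      (fun y j => c * y j)) := fun i => by
    rw [hrow]; infer_instance
  rw [gaussianMatrix, Measure.pi_map_pi (f := fun _ (y : Fin d → ℝ) j => c * y j)
    (fun i => Measurable.aemeasurable (by fun_prop))]
  simp_rw [hrow]
  rfl

theorem integral_gaussianMatrix_smul {φ : (Fin k → Fin d → ℝ) → ℝ} (hφ : Measurable φ)
    (M : Matrix (Fin k) (Fin d) ℝ) (v c : ℝ) :
    ∫ a, φ a ∂gaussianMatrix (c • M) (c ^ 2 * v)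
      = ∫ a, φ (fun i j => c * a i j) ∂gaussianMatrix M v := by
  rw [← gaussianMatrix_map_smul, integral_map (Measurable.aemeasurable (by fun_prop))
    hφ.aestronglyMeasurable]

end Scaling

/-! ### The smallest eigenvalue as a minimum of Rayleigh quotients. -/

section Eigenvalues

variable {E : Type*} [NormedAddCommGroup E] [InnerProductSpace ℝ E] [FiniteDimensional ℝ E]
  [Nontrivial E]

theorem finite_eigenvalues (T : E →ₗ[ℝ] E) : {μ : ℝ | Module.End.HasEigenvalue T μ}.Finite :=
  Module.End.finite_hasEigenvalue T

theorem nonempty_eigenvalues {T : E →L[ℝ] E} (hT : (T : E →ₗ[ℝ] E).IsSymmetric) :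
    {μ : ℝ | Module.End.HasEigenvalue (T : E →ₗ[ℝ] E) μ}.Nonempty :=
  ⟨_, hT.hasEigenvalue_iInf_of_finiteDimensional⟩

theorem exists_isMinEigenvector {g : E → ℝ} {p : E}
    (hT : (hessian g p : E →ₗ[ℝ] E).IsSymmetric) : ∃ v, IsMinEigenvector g p v := by
  have hmem : Module.End.HasEigenvalue (hessian g p : E →ₗ[ℝ] E) (hessianMinEig g p) :=
    (nonempty_eigenvalues hT).csInf_mem (finite_eigenvalues _)
  obtain ⟨v, hv⟩ := hmem.exists_hasEigenvector
  have hv0 : ‖v‖ ≠ 0 := norm_ne_zero_iff.2 hv.2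
  refine ⟨‖v‖⁻¹ • v, ⟨?_, ?_⟩, ?_⟩
  · exact Submodule.smul_mem _ _ hv.1
  · exact smul_ne_zero (inv_ne_zero hv0) hv.2
  · rw [norm_smul, norm_inv, norm_norm, inv_mul_cancel₀ hv0]

/-- In finite dimension the infimum of the Rayleigh quotients is itself an eigenvalue, so the
smallest eigenvalue lies below every quotient. -/
theorem hessianMinEig_le_inner {g : E → ℝ} {p : E}
    (hT : (hessian g p : E →ₗ[ℝ] E).IsSymmetric) {e : E} (he : ‖e‖ = 1) :
    hessianMinEig g p ≤ inner ℝ (hessian g p e) e := by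
  have h1 := csInf_le (finite_eigenvalues (hessian g p : E →ₗ[ℝ] E)).bddBelow
    hT.hasEigenvalue_iInf_of_finiteDimensional
  refine h1.trans ?_
  have hbdd : BddBelow (Set.range fun x : {x : E // x ≠ 0} =>
      RCLike.re (inner ℝ ((hessian g p : E →ₗ[ℝ] E) x) (x : E)) / ‖(x : E)‖ ^ 2) := by
    refine ⟨-‖hessian g p‖, ?_⟩
    rintro _ ⟨x, rfl⟩
    exact (abs_le.1 ((hessian g p).rayleighQuotient_le_norm x)).1
  have h2 := ciInf_le hbdd ⟨e, norm_ne_zero_iff.1 (by rw [he]; norm_num)⟩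
  simpa [he] using h2

end Eigenvalues

/-! ### Adding the linear regularizer; negative curvature at near-critical points. -/

section Regularized

variable {k d : ℕ}

/-- The function `f(M, v) + v / 2`. -/
noncomputable def addHalfVar (f : Param k d → ℝ) (p : Param k d) : ℝ := f p + p.var / 2

variable {f : Param k d → ℝ} {p : Param k d}

theorem hasGradientAt_half_var (p : Param k d) :
    HasGradientAt (fun p : Param k d => p.var / 2) ((1 / 2 : ℝ) • varDir) p := by
  have h : (fun p : Param k d => p.var / 2)
      = InnerProductSpace.toDual ℝ (Param k d) ((1 / 2 : ℝ) • varDir) := by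
    funext q
    simp [varDir, Param.var, div_eq_inv_mul, EuclideanSpace.inner_single_left]
  rw [hasGradientAt_iff_hasFDerivAt, h]
  exact ContinuousLinearMap.hasFDerivAt _

theorem gradient_addHalfVar (hf : DifferentiableAt ℝ f p) :
    DifferentiableAt ℝ (addHalfVar f) p ∧
      gradient (addHalfVar f) p = gradient f p + (1 / 2 : ℝ) • varDir := by
  have h1 := hf.hasGradientAt.hasFDerivAt.add (hasGradientAt_half_var p).hasFDerivAt
  rw [← map_add] at h1
  have h2 : HasGradientAt (addHalfVar f) (gradient f p + (1 / 2 : ℝ) • varDir) p := h1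
  exact ⟨h2.differentiableAt, h2.gradient⟩

theorem hessian_addHalfVar (hf : ∀ᶠ q in nhds p, DifferentiableAt ℝ f q)
    (hg : DifferentiableAt ℝ (gradient f) p) :
    DifferentiableAt ℝ (gradient (addHalfVar f)) p ∧
      hessian (addHalfVar f) p = hessian f p := by
  have h1 : gradient (addHalfVar f) =ᶠ[nhds p] fun q => gradient f q + (1 / 2 : ℝ) • varDir := by
    filter_upwards [hf] with q hq using (gradient_addHalfVar hq).2
  refine ⟨(hg.add_const _).congr_of_eventuallyEq h1, ?_⟩
  rw [hessian, h1.fderiv_eq, fderiv_add_const, hessian]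

theorem IsSmoothOn.addHalfVar {L : ℝ} {S : Set (Param k d)} (h : IsSmoothOn f L S) :
    IsSmoothOn (addHalfVar f) L S := by
  refine ⟨fun p hp => (gradient_addHalfVar (h.1 p hp)).1, fun p hp q hq => ?_⟩
  rw [(gradient_addHalfVar (h.1 p hp)).2, (gradient_addHalfVar (h.1 q hq)).2,
    add_sub_add_right_eq_sub]
  exact h.2 p hp q hq

theorem IsHessianLipschitzOn.addHalfVar {K : ℝ} {S : Set (Param k d)}
    (h : IsHessianLipschitzOn f K S) (hf : ∀ p ∈ S, ∀ᶠ q in nhds p, DifferentiableAt ℝ f q) :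
    IsHessianLipschitzOn (addHalfVar f) K S := by
  have hh := fun p hp => hessian_addHalfVar (hf p hp) (h.1 p hp).2
  refine ⟨fun p hp => ⟨(gradient_addHalfVar (h.1 p hp).1).1, (hh p hp).1⟩, fun p hp q hq => ?_⟩
  rw [(hh p hp).2, (hh q hq).2]
  exact h.2 p hp q hq

theorem IsSmoothOn.mono {E : Type*} [NormedAddCommGroup E] [InnerProductSpace ℝ E]
    [CompleteSpace E] {g : E → ℝ} {L L' : ℝ} {S S' : Set E} (h : IsSmoothOn g L S)
    (hL : L ≤ L') (hS : S' ⊆ S) : IsSmoothOn g L' S' :=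
  ⟨fun p hp => h.1 p (hS hp), fun p hp q hq => (h.2 p (hS hp) q (hS hq)).trans (by gcongr)⟩

theorem IsHessianLipschitzOn.mono {E : Type*} [NormedAddCommGroup E] [InnerProductSpace ℝ E]
    [CompleteSpace E] {g : E → ℝ} {L L' : ℝ} {S S' : Set E} (h : IsHessianLipschitzOn g L S)
    (hL : L ≤ L') (hS : S' ⊆ S) : IsHessianLipschitzOn g L' S' :=
  ⟨fun p hp => h.1 p (hS hp), fun p hp q hq => (h.2 p (hS hp) q (hS hq)).trans (by gcongr)⟩

/-- By the heat equation, an approximately critical point of the regularized average has a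
direction of large negative curvature. -/
theorem hessianMinEig_mul_le {φ : (Fin k → Fin d → ℝ) → ℝ} {C : ℝ} (hφ : Measurable φ)
    (hC : ∀ a, |φ a| ≤ C) (hv : 0 < p.var) {ρ : ℝ}
    (hρ : ‖gradient (addHalfVar (gaussianAverage φ)) p‖ ≤ ρ) :
    (∃ v, IsMinEigenvector (addHalfVar (gaussianAverage φ)) p v) ∧
      hessianMinEig (addHalfVar (gaussianAverage φ)) p * (k * d) ≤ 2 * ρ - 1 := by
  have hmem : {p : Param k d | 0 < p.var} ∈ nhds p := isOpen_var_pos.mem_nhds hv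
  have hcd := contDiffOn_gaussianAverage hφ hC 3
  have hdiff : ∀ᶠ q in nhds p, DifferentiableAt ℝ (gaussianAverage φ) q := by
    filter_upwards [hmem] with q hq
    exact (hcd.differentiableOn (by norm_num)).differentiableAt (isOpen_var_pos.mem_nhds hq)
  have hgd : DifferentiableAt ℝ (gradient (gaussianAverage φ)) p :=
    ((hcd.gradient_of_isOpen (m := 2) (n := 3) isOpen_var_pos (by norm_num)).differentiableOn
      (by norm_num)).differentiableAt hmem
  have hH := (hessian_addHalfVar hdiff hgd).2
  have hsym : (hessian (addHalfVar (gaussianAverage φ)) p : Param k d →ₗ[ℝ] Param k d).IsSymmetric := by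
    rw [hH]
    exact isSymmetric_hessian ((hcd.contDiffAt hmem).of_le (by norm_num))
  refine ⟨exists_isMinEigenvector hsym, ?_⟩
  have h1 : inner ℝ (gradient (addHalfVar (gaussianAverage φ)) p) varDir ≤ ρ := by
    refine (real_inner_le_norm _ _).trans ?_
    rwa [norm_varDir, mul_one]
  rw [(gradient_addHalfVar hdiff.self_of_nhds).2, inner_add_left, inner_smul_left,
    real_inner_self_eq_norm_sq, norm_varDir, heat_equation hφ hC hv, ← hH] at h1
  -- By now `h1` bounds half the trace of the Hessian over the entry directions, plus `1/2`, by `ρ`;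
  -- the trace dominates `kd` copies of the smallest eigenvalue.
  have h2 : ∑ i : Fin k, ∑ j : Fin d, hessianMinEig (addHalfVar (gaussianAverage φ)) p
      ≤ ∑ i, ∑ j, inner ℝ (hessian (addHalfVar (gaussianAverage φ)) p (entryDir i j))
        (entryDir i j) :=
    Finset.sum_le_sum fun i _ => Finset.sum_le_sum fun j _ =>
      hessianMinEig_le_inner hsym (norm_entryDir i j)
  simp only [Finset.sum_const, Finset.card_univ, Fintype.card_fin, nsmul_eq_mul] at h2
  simp only [conj_trivial] at h1
  linarith

end Regularized

/-! ### The objective as the average of a bounded counting function. -/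

section FailureCount

variable {n k d : ℕ}

/-- The number of the vectors `x j` whose image under `a` has distortion at least `ε`. -/
noncomputable def failureCount (x : Fin n → EuclideanSpace ℝ (Fin d)) (ε : ℝ)
    (a : Fin k → Fin d → ℝ) : ℝ :=
  ∑ j, {a : Fin k → Fin d → ℝ |
    normSqImage (Matrix.of a) (x j) ∉ Set.Ioo (1 - ε) (1 + ε)}.indicator 1 a

variable {x : Fin n → EuclideanSpace ℝ (Fin d)} {ε : ℝ}

theorem measurableSet_failure (y : EuclideanSpace ℝ (Fin d)) (ε : ℝ) :
    MeasurableSet {a : Fin k → Fin d → ℝ |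
      normSqImage (Matrix.of a) y ∉ Set.Ioo (1 - ε) (1 + ε)} :=
  (measurable_normSqImage y measurableSet_Ioo).compl

theorem measurable_failureCount :
    Measurable (failureCount x ε : (Fin k → Fin d → ℝ) → ℝ) :=
  Finset.measurable_fun_sum _ fun j _ => measurable_one.indicator (measurableSet_failure (x j) ε)

theorem failureCount_nonneg (a : Fin k → Fin d → ℝ) : 0 ≤ failureCount x ε a :=
  Finset.sum_nonneg fun _ _ => Set.indicator_nonneg (fun _ _ => zero_le_one) _

theorem abs_failureCount_le (a : Fin k → Fin d → ℝ) : |failureCount x ε a| ≤ n := by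
  rw [abs_of_nonneg (failureCount_nonneg a)]
  calc failureCount x ε a ≤ ∑ _j : Fin n, (1 : ℝ) :=
        Finset.sum_le_sum fun _ _ => Set.indicator_le_self' (fun _ _ => zero_le_one) a
    _ = n := by simp

theorem failureSum_eq_gaussianAverage (p : Param k d) :
    failureSum x ε p = gaussianAverage (failureCount x ε) p := by
  simp only [failureSum, gaussianAverage, failureCount]
  have hi : ∀ j ∈ Finset.univ, Integrable ({a : Fin k → Fin d → ℝ |
      normSqImage (Matrix.of a) (x j) ∉ Set.Ioo (1 - ε) (1 + ε)}.indicator 1)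
      (gaussianMatrix p.mean p.var) := fun j _ =>
    (integrable_const (1 : ℝ)).indicator (measurableSet_failure (x j) ε)
  rw [integral_finsetSum _ hi]
  refine Finset.sum_congr rfl fun j _ => ?_
  rw [integral_indicator_one (measurableSet_failure (x j) ε)]

theorem objective_eq_addHalfVar :
    (objective x ε : Param k d → ℝ) = addHalfVar (gaussianAverage (failureCount x ε)) := by
  funext p
  rw [objective, failureSum_eq_gaussianAverage, addHalfVar]

theorem failureSum_nonneg (p : Param k d) : 0 ≤ failureSum x ε p :=
  Finset.sum_nonneg fun _ _ => measureReal_nonneg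

theorem failureSum_le (p : Param k d) : failureSum x ε p ≤ n := by
  calc failureSum x ε p ≤ ∑ _j : Fin n, (1 : ℝ) :=
        Finset.sum_le_sum fun _ _ => measureReal_le_one
    _ = n := by simp

end FailureCount

/-! ### The case `ε ≤ 1`: from a small objective to a good mean matrix. -/

section SmallDistortion

variable {n k d : ℕ} {x : Fin n → EuclideanSpace ℝ (Fin d)} {ε : ℝ}

theorem mul_log_le_of_mul_sqrt_le {C : ℝ} (hC : 0 ≤ C) (hk : 1 ≤ k)
    (hε : C * Real.sqrt (Real.log n / k) ≤ ε) : C ^ 2 * Real.log n ≤ k * ε ^ 2 := by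
  have hk0 : (0 : ℝ) < k := by exact_mod_cast hk
  have h1 : (C * Real.sqrt (Real.log n / k)) ^ 2 ≤ ε ^ 2 := by gcongr
  rw [mul_pow, Real.sq_sqrt (div_nonneg (Real.log_natCast_nonneg n) hk0.le), ← mul_div_assoc,
    div_le_iff₀ hk0] at h1
  linarith

/-- The constant 8 gives `kε² ≥ 64 log n`, so each failure has probability at most `2 n⁻⁸`. -/
theorem failureSum_init_le (hn : 2 ≤ n) (hk : 1 ≤ k) (hε0 : 0 ≤ ε) (hε1 : ε ≤ 1)
    (hε : 8 * Real.sqrt (Real.log n / k) ≤ ε) (hx : ∀ j, ‖x j‖ = 1) :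
    failureSum x ε (Param.mk (0 : Matrix (Fin k) (Fin d) ℝ) 1) ≤ 1 / 4 := by
  have hn0 : (2 : ℝ) ≤ n := by exact_mod_cast hn
  have hlog := mul_log_le_of_mul_sqrt_le (by norm_num) hk hε
  have hexp : Real.exp (-(k * ε ^ 2 / 8)) ≤ ((n : ℝ) ^ 8)⁻¹ := by
    rw [← Real.exp_log (show (0 : ℝ) < n by linarith), ← Real.exp_nat_mul, ← Real.exp_neg]
    gcongr
    push_cast
    linarith
  calc failureSum x ε (Param.mk (0 : Matrix (Fin k) (Fin d) ℝ) 1)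
      ≤ ∑ _j : Fin n, 2 * ((n : ℝ) ^ 8)⁻¹ := Finset.sum_le_sum fun j _ =>
        (real_normSqImage_notMem_Ioo_le hk hε0 hε1 (hx j)).trans (by gcongr)
    _ = 2 * ((n : ℝ) ^ 7)⁻¹ := by
        rw [Finset.sum_const, Finset.card_univ, Fintype.card_fin, nsmul_eq_mul]
        field_simp
    _ ≤ 2 * ((2 : ℝ) ^ 7)⁻¹ := by gcongr
    _ ≤ 1 / 4 := by norm_num

/-- Moving a vector of length `O(√k)` by `O(1)` changes its squared length by `O(√k)`, which is
`O(kε)` since `√k ε ≥ 6`. -/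
theorem abs_sq_sub_le_of_near {u w : EuclideanSpace ℝ (Fin k)} (hε0 : 0 < ε) (hε1 : ε ≤ 1)
    (hk : 36 ≤ k * ε ^ 2) (hu : |‖u‖ ^ 2 - k| ≤ k * ε) (huw : ‖u - w‖ ^ 2 ≤ 8) :
    |‖w‖ ^ 2 - k| ≤ k * (3 * ε) := by
  have hk0 : (0 : ℝ) ≤ k := Nat.cast_nonneg k
  have hd : ‖u - w‖ ≤ 3 := by nlinarith [norm_nonneg (u - w)]
  have h1 := (abs_norm_sub_norm_le u w).trans hd
  set s := √(k : ℝ) with hs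
  have hss : s ^ 2 = k := Real.sq_sqrt hk0
  have hs0 : 0 ≤ s := Real.sqrt_nonneg _
  have hsε : 6 ≤ s * ε := by
    have : 6 ^ 2 ≤ (s * ε) ^ 2 := by rw [mul_pow, hss]; linarith
    exact le_of_sq_le_sq this (by positivity)
  have hus : ‖u‖ ≤ 3 / 2 * s := by
    refine le_of_sq_le_sq ?_ (by positivity)
    rw [mul_pow, hss]
    have := (abs_le.1 hu).2
    nlinarith
  have h2 : |‖w‖ ^ 2 - ‖u‖ ^ 2| ≤ 3 * (3 * s + 3) := by
    rw [sq_sub_sq, abs_mul, abs_of_nonneg (by positivity), mul_comm, abs_sub_comm]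
    have h3 := (abs_le.1 h1).1
    exact mul_le_mul h1 (by linarith) (by positivity) (by norm_num)
  have h4 : 3 * (3 * s + 3) ≤ k * (2 * ε) := by
    rw [← hss]
    nlinarith
  calc |‖w‖ ^ 2 - k| = |(‖w‖ ^ 2 - ‖u‖ ^ 2) + (‖u‖ ^ 2 - k)| := by ring_nf
    _ ≤ _ := abs_add_le _ _
    _ ≤ k * (2 * ε) + k * ε := add_le_add (h2.trans h4) hu
    _ = _ := by ring

/-- The expectation of `‖(A - M) x_j‖²` is `kσ² ≤ 1`, so it reaches 8 with probability at most
`1/8`. As `3/4 + 1/8 < 1`, some `A` avoids both bad events; `A` may depend on `j`, since only `M` is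
reported. -/
theorem hasDistortionAtMost_of_failureSum_le (hk : 1 ≤ k) (hε0 : 0 < ε) (hε1 : ε ≤ 1)
    (hkε : 36 ≤ k * ε ^ 2) (hx : ∀ j, ‖x j‖ = 1) {p : Param k d} (hv : 0 ≤ p.var)
    (hvk : p.var ≤ 1 / k) (hp : failureSum x ε p ≤ 3 / 4) :
    HasDistortionAtMost p.mean x (3 * ε) := by
  intro j
  have hk0 : (0 : ℝ) < k := by exact_mod_cast hk
  set μ := gaussianMatrix p.mean p.var with hμ
  have hfail : μ.real {a | normSqImage (Matrix.of a) (x j) ∉ Set.Ioo (1 - ε) (1 + ε)} ≤ 3 / 4 :=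
    (Finset.single_le_sum (f := fun j => μ.real
      {a | normSqImage (Matrix.of a) (x j) ∉ Set.Ioo (1 - ε) (1 + ε)})
      (fun _ _ => measureReal_nonneg) (Finset.mem_univ j)).trans hp
  let X : (Fin k → Fin d → ℝ) → ℝ := fun a =>
    ∑ i, (∑ l, a i l * x j l - ∑ l, p.mean i l * x j l) ^ 2
  have hXint : Integrable X μ :=
    integrable_finsetSum _ fun i _ => (integral_sq_sub_mean_row p.mean hv (hx j) i).1
  have hX : ∫ a, X a ∂μ ≤ 1 := by
    simp only [X]
    rw [integral_finsetSum _ fun i _ => (integral_sq_sub_mean_row p.mean hv (hx j) i).1]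
    rw [Finset.sum_congr rfl fun i _ => (integral_sq_sub_mean_row p.mean hv (hx j) i).2,
      Finset.sum_const, Finset.card_univ, Fintype.card_fin, nsmul_eq_mul]
    rwa [le_div_iff₀ hk0, mul_comm] at hvk
  have hmarkov := mul_meas_ge_le_integral_of_nonneg
    (.of_forall fun a => Finset.sum_nonneg fun i _ => sq_nonneg _) hXint 8
  have hunion : μ.real ({a | normSqImage (Matrix.of a) (x j) ∉ Set.Ioo (1 - ε) (1 + ε)} ∪
      {a | 8 ≤ X a}) < 1 := by
    have := measureReal_union_le (μ := μ)
      {a | normSqImage (Matrix.of a) (x j) ∉ Set.Ioo (1 - ε) (1 + ε)} {a | 8 ≤ X a}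
    linarith
  obtain ⟨a, ha⟩ : ∃ a, a ∉ {a | normSqImage (Matrix.of a) (x j) ∉ Set.Ioo (1 - ε) (1 + ε)} ∪
      {a | 8 ≤ X a} := by
    by_contra! hall
    rw [Set.eq_univ_of_forall hall, probReal_univ] at hunion
    exact lt_irrefl _ hunion
  rw [Set.mem_union, not_or] at ha
  have h1 : normSqImage (Matrix.of a) (x j) ∈ Set.Ioo (1 - ε) (1 + ε) := not_not.1 ha.1
  have h2 : X a < 8 := not_le.1 ha.2
  have key := abs_sq_sub_le_of_near
    (u := (WithLp.toLp 2 (Matrix.of a *ᵥ (x j).ofLp) : EuclideanSpace ℝ (Fin k)))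
    (w := WithLp.toLp 2 (p.mean *ᵥ (x j).ofLp)) hε0 hε1 hkε ?_ ?_
  · rw [normSqImage, one_div_mul_eq_div, div_sub_one hk0.ne', abs_div, abs_of_pos hk0,
      div_le_iff₀ hk0, mul_comm (3 * ε)]
    exact key
  · rw [normSqImage, one_div_mul_eq_div, Set.mem_Ioo, lt_div_iff₀ hk0, div_lt_iff₀ hk0] at h1
    rw [abs_le]
    constructor <;> nlinarith [h1.1, h1.2]
  · refine le_of_eq_of_le ?_ h2.le
    simp [X, EuclideanSpace.norm_sq_eq, Matrix.mulVec, dotProduct]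

end SmallDistortion

/-! ### The case `ε > 1`: the run stays on the slice `M = 0`. -/

section LargeDistortion

variable {n k d : ℕ} {x : Fin n → EuclideanSpace ℝ (Fin d)} {ε : ℝ}

theorem normSqImage_smul (c : ℝ) (A : Matrix (Fin k) (Fin d) ℝ) (y : EuclideanSpace ℝ (Fin d)) :
    normSqImage (c • A) y = c ^ 2 * normSqImage A y := by
  have h : ∀ i, ∑ j, (c • A) i j * y j = c * ∑ j, A i j * y j := fun i => by
    rw [Finset.mul_sum]
    exact Finset.sum_congr rfl fun j _ => by rw [Matrix.smul_apply, smul_eq_mul, mul_assoc]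
  simp_rw [normSqImage_eq, h, mul_pow, ← Finset.mul_sum]
  ring

theorem normSqImage_nonneg (A : Matrix (Fin k) (Fin d) ℝ) (y : EuclideanSpace ℝ (Fin d)) :
    0 ≤ normSqImage A y := by unfold normSqImage; positivity

theorem failureCount_neg (a : Fin k → Fin d → ℝ) :
    failureCount x ε (fun i j => -1 * a i j) = failureCount x ε a := by
  have h : ∀ j, normSqImage (Matrix.of fun i j => -1 * a i j) (x j)
      = normSqImage (Matrix.of a) (x j) := fun j => by
    have := normSqImage_smul (-1) (Matrix.of a) (x j)
    rw [neg_one_sq, one_mul] at this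
    exact this
  simp only [failureCount, Set.indicator_apply, Set.mem_ofPred_eq, h, Pi.one_apply]

/-- Since `1 - ε < 0`, only the upper end of the interval can be violated, and stretching keeps it
violated. -/
theorem failureCount_le_smul (hε : 1 < ε) {c : ℝ} (hc : 1 ≤ c) (a : Fin k → Fin d → ℝ) :
    failureCount x ε a ≤ failureCount x ε (fun i j => c * a i j) := by
  refine Finset.sum_le_sum fun j _ => ?_
  have h : normSqImage (Matrix.of fun i j => c * a i j) (x j)
      = c ^ 2 * normSqImage (Matrix.of a) (x j) := normSqImage_smul c (Matrix.of a) (x j)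
  have h0 := normSqImage_nonneg (Matrix.of a) (x j)
  by_cases ha : a ∈ {a : Fin k → Fin d → ℝ |
      normSqImage (Matrix.of a) (x j) ∉ Set.Ioo (1 - ε) (1 + ε)}
  · have ha' : (fun i j => c * a i j) ∈ {a : Fin k → Fin d → ℝ |
        normSqImage (Matrix.of a) (x j) ∉ Set.Ioo (1 - ε) (1 + ε)} := by
      rintro ⟨-, h2⟩
      refine ha ⟨by linarith, lt_of_le_of_lt ?_ h2⟩
      rw [h]
      exact le_mul_of_one_le_left h0 (one_le_pow₀ hc)
    rw [Set.indicator_of_mem ha, Set.indicator_of_mem ha']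
    rfl
  · rw [Set.indicator_of_notMem ha]
    exact Set.indicator_nonneg (fun _ _ => zero_le_one) _

/-- The restriction of the average of an even function to the slice `M = 0` is critical in `M`. -/
theorem inner_gradient_entryDir_eq_zero {φ : (Fin k → Fin d → ℝ) → ℝ} {C : ℝ} (hφ : Measurable φ)
    (hC : ∀ a, |φ a| ≤ C) (heven : ∀ a, φ (fun i j => -1 * a i j) = φ a) {p : Param k d}
    (hv : 0 < p.var) (hp : p.mean = 0) (i : Fin k) (j : Fin d) :
    inner ℝ (gradient (gaussianAverage φ) p) (entryDir i j) = 0 := by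
  have hd : DifferentiableAt ℝ (gaussianAverage φ) (p + (0 : ℝ) • entryDir i j) := by
    rw [zero_smul, add_zero]
    exact ((contDiffOn_gaussianAverage hφ hC 1).differentiableOn (by norm_num)).differentiableAt
      (isOpen_var_pos.mem_nhds hv)
  have h1 := hasDerivAt_comp_line hd
  rw [zero_smul, add_zero] at h1
  have hsymm : ∀ t : ℝ, gaussianAverage φ (p + (-t) • entryDir i j)
      = gaussianAverage φ (p + t • entryDir i j) := by
    intro t
    have hvar : ∀ t : ℝ, (p + t • entryDir i j).var = p.var := fun t => by
      simp [Param.var, entryDir]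
    have hmean : (p + (-t) • entryDir i j).mean = (-1 : ℝ) • (p + t • entryDir i j).mean := by
      ext i' j'
      have := congrFun (congrFun hp i') j'
      simp only [Param.mean, Matrix.of_apply, Matrix.zero_apply] at this
      simp [Param.mean, this]
    have h2 := integral_gaussianMatrix_smul hφ (p + t • entryDir i j).mean p.var (-1)
    rw [neg_one_sq, one_mul] at h2
    rw [gaussianAverage, gaussianAverage, hvar, hvar, hmean, h2]
    simp_rw [heven]
  have h3 : HasDerivAt (fun t : ℝ => -t) (-1) 0 := hasDerivAt_neg 0
  have h4 : HasDerivAt (fun t : ℝ => gaussianAverage φ (p + (-t) • entryDir i j))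
      (inner ℝ (gradient (gaussianAverage φ) p) (entryDir i j) * -1) 0 := by
    rw [← neg_zero] at h1
    exact h1.comp (0 : ℝ) h3
  simp_rw [hsymm] at h4
  have := h1.unique h4
  linarith

/-- At `M = 0`, raising the variance from `v` to `v + t` stretches the sample by `√((v + t)/v) ≥ 1`,
so the average cannot decrease. -/
theorem inner_gradient_varDir_nonneg {φ : (Fin k → Fin d → ℝ) → ℝ} {C : ℝ} (hφ : Measurable φ)
    (hC : ∀ a, |φ a| ≤ C) (hmono : ∀ c : ℝ, 1 ≤ c → ∀ a, φ a ≤ φ (fun i j => c * a i j))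
    {p : Param k d} (hv : 0 < p.var) (hp : p.mean = 0) :
    0 ≤ inner ℝ (gradient (gaussianAverage φ) p) varDir := by
  have hd : DifferentiableAt ℝ (gaussianAverage φ) (p + (0 : ℝ) • varDir) := by
    rw [zero_smul, add_zero]
    exact ((contDiffOn_gaussianAverage hφ hC 1).differentiableOn (by norm_num)).differentiableAt
      (isOpen_var_pos.mem_nhds hv)
  have h1 := hasDerivAt_comp_line hd
  rw [zero_smul, add_zero] at h1
  have hle : ∀ t : ℝ, 0 < t → gaussianAverage φ p ≤ gaussianAverage φ (p + t • varDir) := by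
    intro t ht
    have hvar : (p + t • varDir).var = p.var + t := by simp [Param.var, varDir]
    have hmean : (p + t • varDir).mean = p.mean := by
      ext i j
      simp [Param.mean, varDir]
    set c := √((p.var + t) / p.var) with hc
    have hc1 : 1 ≤ c := by
      rw [hc, Real.one_le_sqrt, one_le_div hv]; linarith
    have hcsq : c ^ 2 * p.var = p.var + t := by
      rw [hc, Real.sq_sqrt (by positivity)]; field_simp
    have h2 := integral_gaussianMatrix_smul hφ p.mean p.var c
    rw [gaussianAverage, gaussianAverage, hvar, hmean, ← hcsq]
    have h3 : c • p.mean = p.mean := by rw [hp, smul_zero]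
    rw [h3] at h2
    rw [h2]
    have hb : ∀ ψ : (Fin k → Fin d → ℝ) → ℝ, Measurable ψ → (∀ a, |ψ a| ≤ C) →
        Integrable ψ (gaussianMatrix p.mean p.var) := fun ψ hψ hψC =>
      (integrable_const C).mono' hψ.aestronglyMeasurable (.of_forall hψC)
    exact integral_mono (hb φ hφ hC) (hb _ (hφ.comp (by fun_prop)) fun a => hC _) (hmono c hc1)
  have h2 := h1.tendsto_slope.mono_left (nhdsWithin_mono (0 : ℝ)
    (show Set.Ioi (0 : ℝ) ⊆ {0}ᶜ from fun t ht => ne_of_gt ht))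
  refine ge_of_tendsto h2 ?_
  filter_upwards [self_mem_nhdsWithin] with t ht
  have ht' : (0 : ℝ) < t := ht
  rw [slope_def_field, zero_smul, add_zero, sub_zero]
  exact div_nonneg (sub_nonneg.2 (hle t ht')) ht'.le

theorem gradient_objective_of_mean_eq_zero (hε : 1 < ε) {p : Param k d} (hv : 0 < p.var)
    (hp : p.mean = 0) :
    (gradient (objective x ε) p).mean = 0 ∧ 1 / 2 ≤ ‖gradient (objective x ε) p‖ := by
  have hd : DifferentiableAt ℝ (gaussianAverage (failureCount x ε)) p :=
    ((contDiffOn_gaussianAverage measurable_failureCount abs_failureCount_le 1).differentiableOn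
      (by norm_num)).differentiableAt (isOpen_var_pos.mem_nhds hv)
  rw [objective_eq_addHalfVar, (gradient_addHalfVar hd).2]
  constructor
  · ext i j
    have := inner_gradient_entryDir_eq_zero (measurable_failureCount (x := x) (ε := ε)) abs_failureCount_le
      failureCount_neg hv hp i j
    simp only [entryDir, EuclideanSpace.inner_single_right] at this
    simp [Param.mean, varDir]
    simpa using this
  · have h1 := inner_gradient_varDir_nonneg (measurable_failureCount (x := x) (ε := ε)) abs_failureCount_le
      (fun c hc a => failureCount_le_smul hε hc a) hv hp
    have h2 := real_inner_le_norm
      (gradient (gaussianAverage (failureCount x ε)) p + (1 / 2 : ℝ) • varDir) varDir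
    rw [norm_varDir, mul_one, inner_add_left, inner_smul_left, real_inner_self_eq_norm_sq,
      norm_varDir] at h2
    simp only [conj_trivial] at h2
    linarith

end LargeDistortion

/-! ### Polynomial parameters in terms of `P = nkd`. -/

section Parameters

variable {n k d : ℕ} {x : Fin n → EuclideanSpace ℝ (Fin d)} {ε P : ℝ}

/-- The slice bounds with variance floor `1/(2P)`, `η = 1/(8P)`, radius `1/(16P²)` and bound `3n`.
Numerical constants are absorbed into powers of `P ≥ 2`. -/
theorem objective_regularity (hP : 2 ≤ P) (hn : (n : ℝ) ≤ P) (hkd : (k * d : ℝ) ≤ P) :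
    IsSmoothOn (objective (k := k) x ε) (P ^ 18) {p | 1 / P / 2 ≤ p.var} ∧
    IsHessianLipschitzOn (objective (k := k) x ε) (P ^ 28) {p | 1 / P / 2 ≤ p.var} ∧
    ∀ p : Param k d, 1 / P / 2 ≤ p.var → ‖gradient (objective x ε) p‖ ≤ P ^ 10 := by
  have hP0 : 0 < P := by linarith
  have hv₀ : 0 < 1 / P / 2 := by positivity
  have hv₀1 : 1 / P / 2 ≤ 1 := by rw [div_div, div_le_one (by positivity)]; linarith
  have hη : 0 < 1 / (8 * P) := by positivity
  have hη8 : 1 / (8 * P) ≤ 1 / 8 := by gcongr; linarith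
  have hN : 1 / (8 * P) * (k * d) ≤ 1 / 8 := by
    rw [one_div_mul_eq_div, div_le_iff₀ (by positivity)]; linarith
  have hsl := hasHolomorphicSlices_gaussianAverage (k := k) (d := d) (φ := failureCount x ε)
    measurable_failureCount abs_failureCount_le hv₀ hv₀1 hη hη8 hN
  have hcd := contDiffOn_gaussianAverage (k := k) (d := d) (φ := failureCount x ε)
    measurable_failureCount abs_failureCount_le 3
  have hreq : 1 / (8 * P) * (1 / P / 2) = 1 / (16 * P ^ 2) := by field_simp; norm_num
  rw [hreq] at hsl
  have hr : 0 < 1 / (16 * P ^ 2) := by positivity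
  have hB : (0 : ℝ) ≤ 3 * n := by positivity
  have hSU : ∀ p ∈ {p : Param k d | 1 / P / 2 ≤ p.var}, ∀ q : Param k d,
      ‖q‖ < 1 / (16 * P ^ 2) → p + q ∈ {p : Param k d | 0 < p.var} := by
    intro p hp q hq
    have hp' : 1 / P / 2 ≤ p.var := hp
    have h1 := neg_abs_le q.var
    have h2 := q.abs_var_le
    have h3 : 1 / (16 * P ^ 2) ≤ 1 / P / 2 := by
      rw [← hreq]
      exact mul_le_of_le_one_left hv₀.le (by linarith)
    change 0 < p.var + q.var
    linarith
  have hdiff : ∀ p ∈ {p : Param k d | 1 / P / 2 ≤ p.var}, ∀ᶠ q in nhds p,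
      DifferentiableAt ℝ (gaussianAverage (failureCount x ε)) q := by
    intro p hp
    filter_upwards [isOpen_var_pos.mem_nhds (hv₀.trans_le hp)] with q hq
    exact (hcd.differentiableOn (by norm_num)).differentiableAt (isOpen_var_pos.mem_nhds hq)
  have hpow : ∀ m : ℕ, (2 : ℝ) ^ m ≤ P ^ m := fun m => by gcongr
  rw [objective_eq_addHalfVar]
  refine ⟨(hsl.isSmoothOn hr hB isOpen_var_pos hcd hSU (convex_var_ge _)).addHalfVar.mono ?_
    le_rfl, ((hsl.isHessianLipschitzOn hr hB isOpen_var_pos hcd hSU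
      (convex_var_ge _)).addHalfVar hdiff).mono ?_ le_rfl, fun p hp => ?_⟩
  · calc 8 * (3 * n) / (1 / (16 * P ^ 2)) ^ 2 = 6144 * n * P ^ 4 := by field_simp; ring
      _ ≤ 2 ^ 13 * P * P ^ 4 := by gcongr; norm_num
      _ ≤ P ^ 13 * P * P ^ 4 := by gcongr
      _ = P ^ 18 := by ring
  · calc 144 * (3 * n) / (1 / (16 * P ^ 2)) ^ 3 = 1769472 * n * P ^ 6 := by field_simp; ring
      _ ≤ 2 ^ 21 * P * P ^ 6 := by gcongr; norm_num
      _ ≤ P ^ 21 * P * P ^ 6 := by gcongr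
      _ = P ^ 28 := by ring
  · rw [(gradient_addHalfVar (hdiff p hp).self_of_nhds).2]
    calc _ ≤ ‖gradient (gaussianAverage (failureCount x ε)) p‖ + ‖(1 / 2 : ℝ) • varDir‖ :=
          norm_add_le _ _
      _ ≤ 2 * (3 * n) / (1 / (16 * P ^ 2)) + 1 / 2 := by
          gcongr
          · exact hsl.norm_gradient_le hr hB isOpen_var_pos hcd hSU hp
          · rw [norm_smul, norm_varDir]; norm_num
      _ = 96 * n * P ^ 2 + 1 / 2 := by field_simp; ring
      _ ≤ 96 * P * P ^ 2 + 1 * P ^ 3 := by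
          gcongr
          linarith [hpow 3]
      _ = 97 * P ^ 3 := by ring
      _ ≤ P ^ 7 * P ^ 3 := by gcongr; linarith [hpow 7]
      _ = P ^ 10 := by ring

theorem descentData_objective (hP : 2 ≤ P) (hn : (n : ℝ) ≤ P) (hkd1 : (1 : ℝ) ≤ k * d)
    (hkd : (2 * (k * d) : ℝ) ≤ P) {ρ : ℝ} (hρ : 0 < ρ) (hρP : ρ ≤ 1 / P ^ 64) :
    DescentData (objective (k := k) x ε) (P ^ 18) (P ^ 28) ρ (1 / P) (P ^ 10) (1 / P ^ 2)
      (ρ ^ 2 / P ^ 58) := by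
  have hP0 : 0 < P := by linarith
  have hP1 : 1 ≤ P := by linarith
  have hpow : ∀ m : ℕ, (2 : ℝ) ^ m ≤ P ^ m := fun m => by gcongr
  have hmono : ∀ {a b : ℕ}, a ≤ b → P ^ a ≤ P ^ b := fun h => pow_le_pow_right₀ hP1 h
  obtain ⟨h1, h2, h3⟩ := objective_regularity (x := x) (ε := ε) (k := k) hP hn
    (by linarith)
  have hσ : Real.sqrt ρ ≤ 1 / P ^ 32 := by
    rw [Real.sqrt_le_left (by positivity), div_pow, ← pow_mul, one_pow]
    exact hρP
  have hσ0 : 0 < Real.sqrt ρ := Real.sqrt_pos.2 hρ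
  have hσσ : Real.sqrt ρ ^ 2 = ρ := Real.sq_sqrt hρ.le
  have hρ1 : ρ ≤ 1 / 4 := hρP.trans (by
    have := hpow 64
    rw [div_le_div_iff₀ (by positivity) (by norm_num)]
    norm_num at this
    linarith)
  refine ⟨by positivity, by positivity, hρ, by positivity, h1, h2, fun p hp => ?_, h3, ?_, ?_,
    fun p hp hg => ?_, ?_, by positivity, ?_, ?_⟩
  · exact add_nonneg (failureSum_nonneg p) (by positivity)
  · rw [div_le_iff₀ (by positivity)]
    calc P ^ 10 ≤ P ^ 16 := hmono (by norm_num)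
      _ = 1 / P / P * P ^ 18 := by field_simp
      _ ≤ _ := by gcongr
  · rw [div_le_iff₀ (by positivity)]
    calc 3 * √ρ ≤ 2 ^ 2 * 1 := by
          gcongr
          · norm_num
          · exact hσ.trans (div_le_one_of_le₀ (one_le_pow₀ hP1) (by positivity))
      _ ≤ P ^ 26 := by
          rw [mul_one]; exact (hpow 2).trans (hmono (by norm_num))
      _ = 1 / P / P * P ^ 28 := by field_simp
      _ ≤ _ := by gcongr
  · have hv : 0 < p.var := lt_of_lt_of_le (by positivity) hp
    rw [objective_eq_addHalfVar] at hg ⊢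
    obtain ⟨hex, hle⟩ := hessianMinEig_mul_le measurable_failureCount abs_failureCount_le hv hg
    refine ⟨hex, ?_⟩
    by_contra! hcon
    have h4 : -(1 / P ^ 2) * (k * d) <
        hessianMinEig (addHalfVar (gaussianAverage (failureCount x ε))) p * (k * d) := by
      gcongr
    -- With `ρ ≤ 1/4` the curvature bound times `kd` is at most `-1/2`, so `-1/P²` leaves room to
    -- spare.
    have h5 : 1 / P ^ 2 * (k * d) ≤ 1 / 4 := by
      rw [one_div_mul_eq_div, div_le_iff₀ (by positivity)]
      nlinarith
    linarith
  · rw [Real.sqrt_mul (by positivity), show P ^ 28 = (P ^ 14) ^ 2 by ring,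
      Real.sqrt_sq (by positivity)]
    calc P ^ 14 * √ρ ≤ P ^ 14 * (1 / P ^ 32) := by gcongr
      _ = 1 / P ^ 18 := by field_simp
      _ < 1 / P ^ 2 := by
          apply one_div_lt_one_div_of_lt (by positivity)
          exact pow_lt_pow_right₀ (by linarith) (by norm_num)
  · gcongr
    calc 2 * P ^ 18 ≤ P * P ^ 18 := by gcongr
      _ = P ^ 19 := by ring
      _ ≤ P ^ 58 := hmono (by norm_num)
  -- The curvature gain is of order `ρ`, while the linear and cubic losses are of order `ρ^{3/2}`;
  -- `√ρ ≤ P⁻³²` makes the gain win.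
  · have e1 : (3 * √ρ / P ^ 28) ^ 2 * (1 / P ^ 2) / 2 - 3 * √ρ / P ^ 28 * ρ
        - P ^ 28 / 6 * (3 * √ρ / P ^ 28) ^ 3
        = ρ / P ^ 58 * (9 / 2 - √ρ * (3 * P ^ 30 + 9 / 2 * P ^ 2)) := by
      have : (√ρ) ^ 3 = √ρ * ρ := by rw [pow_succ, hσσ, mul_comm]
      simp only [div_pow, mul_pow, this, hσσ]
      field_simp
      ring
    rw [e1]
    have e2 : √ρ * (3 * P ^ 30 + 9 / 2 * P ^ 2) ≤ 7 / 2 := by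
      calc √ρ * (3 * P ^ 30 + 9 / 2 * P ^ 2)
          ≤ 1 / P ^ 32 * (3 * P ^ 30 + 9 / 2 * P ^ 30) := by
            gcongr
            norm_num
        _ = (15 / 2) / P ^ 2 := by field_simp; norm_num
        _ ≤ (15 / 2) / 2 ^ 2 := by gcongr
        _ ≤ 7 / 2 := by norm_num
    calc ρ ^ 2 / P ^ 58 ≤ ρ / P ^ 58 * 1 := by
          rw [mul_one]; gcongr; nlinarith
      _ ≤ _ := by gcongr; linarith

end Parameters

/-! ### Choice of constants and conclusion. -/

theorem theorem3 :
    ∃ C D : ℝ, 0 < C ∧ 0 < D ∧ ∃ c : ℕ,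
      ∀ n k d : ℕ, 2 ≤ n → 1 ≤ k → 1 ≤ d →
        -- the parameters of the algorithm, polynomial in `n`, `k`, `d`
        ∃ s L K ρ₀ : ℝ,
          1 / ((n * k * d : ℕ) : ℝ) ^ c ≤ s ∧ s ≤ 1 / (k : ℝ) ∧
          0 < L ∧ L ≤ ((n * k * d : ℕ) : ℝ) ^ c ∧
          0 < K ∧ K ≤ ((n * k * d : ℕ) : ℝ) ^ c ∧
          1 / ((n * k * d : ℕ) : ℝ) ^ c ≤ ρ₀ ∧
          ∀ ε : ℝ, C * Real.sqrt (Real.log n / k) ≤ ε →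
            ∀ x : Fin n → EuclideanSpace ℝ (Fin d), (∀ j, ‖x j‖ = 1) →
              IsSmoothOn (objective (k := k) x ε) L {p | s ≤ p.var} ∧
              IsHessianLipschitzOn (objective (k := k) x ε) K {p | s ≤ p.var} ∧
              ∀ ρ : ℝ, 0 < ρ → ρ ≤ ρ₀ →
                ∀ u : Param k d → Param k d, IsEigenvectorRule (objective x ε) u →
                  ∃ (T : ℕ) (p : Param k d),
                    (T : ℝ) ≤ ((n * k * d : ℕ) : ℝ) ^ c / ρ ^ 2 ∧
                    hessianDescent (objective x ε) L K ρ s u T = .stopped p ∧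
                    0 < p.var ∧
                    HasDistortionAtMost p.mean x (D * ε) := by
  refine ⟨8, 3, by norm_num, by norm_num, 64, fun n k d hn hk hd => ?_⟩
  set P : ℝ := ((n * k * d : ℕ) : ℝ) with hPdef
  have hPeq : P = n * (k * d) := by rw [hPdef]; push_cast; ring
  have hn' : (2 : ℝ) ≤ n := by exact_mod_cast hn
  have hk' : (1 : ℝ) ≤ k := by exact_mod_cast hk
  have hd' : (1 : ℝ) ≤ d := by exact_mod_cast hd
  have hkd1 : (1 : ℝ) ≤ k * d := one_le_mul_of_one_le_of_one_le hk' hd'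
  have hkd : (2 * (k * d) : ℝ) ≤ P := by rw [hPeq]; gcongr
  have hP : 2 ≤ P := by linarith
  have hP0 : 0 < P := by linarith
  have hP1 : 1 ≤ P := by linarith
  have hnP : (n : ℝ) ≤ P := by rw [hPeq]; exact le_mul_of_one_le_right (by linarith) hkd1
  have hkP : (k : ℝ) ≤ P := by nlinarith
  refine ⟨1 / P, P ^ 18, P ^ 28, 1 / P ^ 64, ?_, ?_, by positivity,
    pow_le_pow_right₀ hP1 (by norm_num), by positivity, pow_le_pow_right₀ hP1 (by norm_num), le_rfl,
    fun ε hε x hx => ?_⟩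
  · gcongr; exact le_self_pow₀ hP1 (by norm_num)
  · gcongr
  have hreg := objective_regularity (x := x) (ε := ε) (k := k) hP hnP (by linarith)
  have hsub : {p : Param k d | 1 / P ≤ p.var} ⊆ {p | 1 / P / 2 ≤ p.var} := fun p hp =>
    le_trans (half_le_self (a := 1 / P) (by positivity)) (show 1 / P ≤ p.var from hp)
  refine ⟨hreg.1.mono le_rfl hsub, hreg.2.1.mono le_rfl hsub, fun ρ hρ hρ₀ u hu => ?_⟩
  have hdata := descentData_objective (x := x) (ε := ε) (k := k) hP hnP hkd1 hkd hρ hρ₀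
  have hs1 : 1 / P ≤ 1 := div_le_one_of_le₀ hP1 hP0.le
  obtain ⟨T, p, hT, hres, hpos, hvs, hobj⟩ := hdata.exists_stopped hu hs1
  have hρ1 : ρ ≤ 1 := hρ₀.trans (div_le_one_of_le₀ (one_le_pow₀ hP1) (by positivity))
  refine ⟨T, p, hT.trans ?_, hres, hpos, ?_⟩
  · have h0 : objective x ε (Param.mk (0 : Matrix (Fin k) (Fin d) ℝ) 1) ≤ n + 1 / 2 :=
      add_le_add (failureSum_le _) (by rw [Param.var_mk])
    have h1 : (1 : ℝ) ≤ P ^ 58 / ρ ^ 2 := by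
      rw [one_le_div (by positivity)]
      exact (pow_le_one₀ hρ.le hρ1).trans (one_le_pow₀ hP1)
    calc _ ≤ (n + 1 / 2) / (ρ ^ 2 / P ^ 58) + P ^ 58 / ρ ^ 2 := by gcongr
      _ = (n + 3 / 2) * P ^ 58 / ρ ^ 2 := by field_simp; ring
      _ ≤ P ^ 2 * P ^ 58 / ρ ^ 2 := by gcongr; nlinarith
      _ ≤ P ^ 64 / ρ ^ 2 := by
          rw [← pow_add]
          gcongr
          norm_num
  have hlog2 : Real.log 2 ≤ Real.log n := Real.log_le_log (by norm_num) hn'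
  have hlog : 0 < Real.log n := (Real.log_pos (by norm_num)).trans_le hlog2
  have hε0 : 0 < ε := lt_of_lt_of_le (by positivity) hε
  rcases le_or_gt ε 1 with hε1 | hε1
  -- `kε² ≥ 64 log 2 > 44`.
  · have hkε : 36 ≤ k * ε ^ 2 := by
      have := mul_log_le_of_mul_sqrt_le (by norm_num) hk hε
      linarith [Real.log_two_gt_d9]
    refine hasDistortionAtMost_of_failureSum_le hk hε0 hε1 hkε hx hpos.le
      (hvs.trans (by gcongr)) ?_
    have h0 : objective x ε (Param.mk (0 : Matrix (Fin k) (Fin d) ℝ) 1) ≤ 1 / 4 + 1 / 2 :=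
      add_le_add (failureSum_init_le hn hk hε0.le hε1 hε hx) (by rw [Param.var_mk])
    have h1 : objective x ε p = failureSum x ε p + p.var / 2 := rfl
    linarith
  -- The run returns `M = 0`, of distortion exactly `1`, which is less than `3ε`.
  · obtain ⟨q, hq, hr⟩ := hessianDescent_mean_eq_zero (g := objective x ε) (L := P ^ 18)
      (K := P ^ 28) (ρ := ρ) (s := 1 / P) (u := u) (fun p hp hv => by
        obtain ⟨h1, h2⟩ := gradient_objective_of_mean_eq_zero (x := x) hε1
          (lt_trans (by positivity) hv) hp
        refine ⟨h1, lt_of_lt_of_le ?_ h2⟩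
        calc ρ ≤ 1 / P ^ 64 := hρ₀
          _ < 1 / 2 := by
            apply one_div_lt_one_div_of_lt (by norm_num)
            calc (2 : ℝ) ≤ P ^ 1 := by rw [pow_one]; exact hP
              _ < P ^ 64 := pow_lt_pow_right₀ (by linarith) (by norm_num)) T
    rw [hres] at hr
    rcases hr with hr | hr
    · cases hr
    · cases hr
      intro j
      rw [hq, normSqImage_eq]
      simp only [Matrix.zero_apply, zero_mul, Finset.sum_const_zero, ne_eq, OfNat.ofNat_ne_zero,
        not_false_eq_true, zero_pow, mul_zero, zero_sub, abs_neg, abs_one]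
      linarith
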